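/- An index is a finite sequence $\mathbf k=(k_1,\ldots,k_r)$ of positive integers, of depth $r\ge 0$ and weight $|\mathbf k|=k_1+\cdots+k_r$; the empty index $\emptyset$ has weight $0$. For a nonempty index put $$\mathrm{Li}_{\mathbf k}(z)=\sum_{1\le m_1<\cdots<m_r}\frac{z^{m_r}}{m_1^{k_1}\cdots m_r^{k_r}}\quad(|z|<1),\qquad \xi(\mathbf k;s)=\frac1{\Gamma(s)}\int_0^\infty t^{s-1}\,\frac{\mathrm{Li}_{\mathbf k}(1-e^{-t})}{e^t-1}\,dt\quad(\mathrm{Re}(s)>1-r),$$ and for any index $\mathbf l=(l_1,\ldots,l_r)$ put $$\zeta(\mathbf l;s)=\sum_{1\le m_1<\cdots<m_r<m}\frac1{m_1^{l_1}\cdots m_r^{l_r}m^s}\quad(\mathrm{Re}(s)>1),$$ so that $\zeta(\emptyset;s)=\zeta(s)$ is the Riemann zeta function. A multiple zeta value of weight $w$ is a number $\zeta(\mathbf l)=\sum_{1\le m_1<\cdots<m_r}m_1^{-l_1}\cdots m_r^{-l_r}$ with $|\mathbf l|=w$ and $l_r\ge2$; the constant $1$ is regarded as a multiple zeta value of weight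 $0$ (the case $\mathbf l=\emptyset$). Theorem. The integral and the series above converge absolutely in the indicated regions; $\xi(\mathbf k;s)$ continues to an entire function and $\zeta(\mathbf l;s)$ to a meromorphic function on $\mathbb C$, the latter holomorphic for $\mathrm{Re}(s)>1$. For every nonempty index $\mathbf k$ there are real numbers $c_{\mathbf k}(\mathbf k';j)$, indexed by the (possibly empty) indices $\mathbf k'$ and the integers $j\ge0$ with $|\mathbf k'|+j\le|\mathbf k|$, and independent of $s$, such that each $c_{\mathbf k}(\mathbf k';j)$ is a $\mathbb Q$-linear combination of multiple zeta values of weight $|\mathbf k|-|\mathbf k'|-j$ and $$\xi(\mathbf k;s)=\sum_{|\mathbf k'|+j\le|\mathbf k|}c_{\mathbf k}(\mathbf k';j)\binom{s+j-1}{j}\zeta(\mathbf k';s+j)$$ as meromorphic functions of $s\in\mathbb C$, with equality of values at every $s$ such that $\zeta(\mathbf k';\,\cdot\,)$ has no pole at $s+j$ whenever $c_{\mathbf k}(\mathbf k';j)\ne0$. -/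

import Mathlib

/-- An index `(k₁, …, k_r)`: a finite, possibly empty, list of positive integers.
Its depth `r` is `k.length`. -/
abbrev MZIndex : Type := List ℕ+

/-- The weight `k₁ + ⋯ + k_r` of an index; the empty index has weight `0`. -/
def MZIndex.weight (k : MZIndex) : ℕ := (k.map fun a : ℕ+ => (a : ℕ)).sum

/-- An index is admissible if its last entry is greater than `1`. The empty index is counted as
admissible. -/
def MZIndex.Admissible (k : MZIndex) : Prop := ∀ a ∈ k.getLast?, 1 < a

/-- The multiple zeta value `∑_{1 ≤ m₁ < ⋯ < m_r} 1 / (m₁ ^ k₁ ⋯ m_r ^ k_r)`. An order embedding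
`Fin r ↪o ℕ+` is a strictly increasing `r`-tuple of positive integers. For the empty index
there is one (empty) tuple, and the value is `1`. -/
noncomputable def multiZetaValue (k : MZIndex) : ℝ :=
  ∑' m : Fin k.length ↪o ℕ+, ∏ i, 1 / ((m i : ℕ) : ℝ) ^ (k.get i : ℕ)

/-- The rational linear combinations of multiple zeta values of weight `w` (of admissible
indices; the constant `1` is the multiple zeta value of weight `0`). -/
noncomputable def multiZetaSpan (w : ℕ) : Submodule ℚ ℝ :=
  Submodule.span ℚ {x | ∃ l : MZIndex, l.Admissible ∧ l.weight = w ∧ x = multiZetaValue l}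

/-- The multiple polylogarithm
`Li_k(z) = ∑_{1 ≤ m₁ < ⋯ < m_r} z ^ m_r / (m₁ ^ k₁ ⋯ m_r ^ k_r)` for `|z| < 1`.
The exponent `m_r` is the largest of the `m_i`. -/
noncomputable def multiPolylog (k : MZIndex) (z : ℂ) : ℂ :=
  ∑' m : Fin k.length ↪o ℕ+,
    z ^ (Finset.univ.sup fun i => (m i : ℕ)) / ∏ i, ((m i : ℕ) : ℂ) ^ (k.get i : ℕ)

/-- The integrand `t ^ (s - 1) * Li_k(1 - e ^ (-t)) / (e ^ t - 1)`. -/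
noncomputable def xiIntegrand (k : MZIndex) (s : ℂ) (t : ℝ) : ℂ :=
  (t : ℂ) ^ (s - 1) * (multiPolylog k (1 - Complex.exp (-(t : ℂ))) / (Complex.exp (t : ℂ) - 1))

/-- The integral defining `ξ(k; s)` for `Re s > 1 - r`. At the poles of `Γ` Mathlib's value of
`Γ` is `0`, so `1 / Γ(s)` has its usual value `0` there. -/
noncomputable def xiIntegral (k : MZIndex) (s : ℂ) : ℂ :=
  1 / Complex.Gamma s * ∫ t in Set.Ioi (0 : ℝ), xiIntegrand k s t

/-- The term `1 / (m₁ ^ l₁ ⋯ m_r ^ l_r m ^ s)`, where `(m₁, …, m_r, m)` is a strictly increasing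
tuple of positive integers. -/
noncomputable def multiZetaTerm (l : MZIndex) (s : ℂ) (m : Fin (l.length + 1) ↪o ℕ+) : ℂ :=
  1 / ((∏ i : Fin l.length, ((m i.castSucc : ℕ) : ℂ) ^ (l.get i : ℕ)) *
    ((m (Fin.last l.length) : ℕ) : ℂ) ^ s)

/-- The series defining `ζ(l₁, …, l_r; s)` for `Re s > 1`; for the empty index it is
`∑_{m ≥ 1} 1 / m ^ s`. -/
noncomputable def multiZetaSeries (l : MZIndex) (s : ℂ) : ℂ :=
  ∑' m : Fin (l.length + 1) ↪o ℕ+, multiZetaTerm l s m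

/-- `F` is the meromorphic continuation to `ℂ` of the function `f` given on `U`. The normal form
says that `F` takes the analytic value at every removable singularity (and the value `0` at
poles), so `F` is unique when `U` is open and nonempty. -/
def IsMeromorphicContinuation (f : ℂ → ℂ) (U : Set ℂ) (F : ℂ → ℂ) : Prop :=
  MeromorphicNFOn F Set.univ ∧ Set.EqOn F f U

/-- The meromorphic continuation to `ℂ` of `f` given on `U` (an arbitrary function if there is
none). -/
noncomputable def meromorphicContinuation (f : ℂ → ℂ) (U : Set ℂ) : ℂ → ℂ :=
  Classical.epsilon (IsMeromorphicContinuation f U)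

/-- The function `ξ(k; s)` of `s ∈ ℂ`. -/
noncomputable def xiFunction (k : MZIndex) : ℂ → ℂ :=
  meromorphicContinuation (xiIntegral k) {s | 1 - (k.length : ℝ) < s.re}

/-- The single-variable multiple zeta function `ζ(l₁, …, l_r; s)` of `s ∈ ℂ`. -/
noncomputable def multiZetaFunction (l : MZIndex) : ℂ → ℂ :=
  meromorphicContinuation (multiZetaSeries l) {s | 1 < s.re}

/-! The substitution z = e^(-t) turns -log z into t, so the formula is the Mellin transform of an
identity on (0, 1): each Li_k(1 - z) is a finite sum of terms a (-log z)^j / j! Li_k'(z),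
homogeneous in total weight, with a a rational combination of multiple zeta values
(`hasReflection`). After division by e^t - 1, the function Li_k'(e^(-t)) becomes a series of A(n)
e^(-nt) with A(n) the nested sum below n, so its transform is Γ(s) ζ(k'; s) (`mellin_zetaKernel`).
The factor t^j / j! shifts s to s + j, and Γ(s + j) / (j! Γ(s)) is the binomial coefficient
(`mellin_xiKernel_eq`). This gives the formula for Re s > 1; the identity theorem for meromorphic
functions does the rest.

The reflection identity is proved by induction on the weight. If the exponent of the largest
summation index is at least 2, the derivative of Li(1 - z) is -1/(1 - z) times a function of weight
one less. The span of the allowed products has primitives for this operation (`exists_primitive`),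
and the constant of integration is the limit at z = 0, a multiple zeta value. If that exponent is 1,
this limiting argument is not available. Instead, Li_1 times the polylogarithm of the word with one
leading 1 removed is a positive multiple of the wanted function plus words with fewer leading ones
(`exists_shuffle_ones`), and Li_1(1 - z) = -log z.

For the continuation of ξ, the kernel is expanded in powers of 1 - e^(-t). Each term has an explicit
transform, entire after division by Γ, and removing N terms leaves a remainder bounded by t^N
(`abs_xiRem_le`). For ζ(l; s), Abel summation and the binomial expansion of (1 - 1/m)^(1 - s) link
one depth at s, s + 1, ... to the previous depth at a shifted argument (`LSeries_translation`).
Solving for the value at s moves the half-plane left by one unit at a time, starting from the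
Riemann zeta function. -/

open Filter Topology Set Asymptotics MeasureTheory

/-! ### Nested sums and polylogarithms of words -/

/-- The nested sums `∑_{m₁ < ⋯ < m_r < m} 1 / (m₁ ^ k₁ ⋯ m_r ^ k_r)`; the word lists the
exponents from the last one to the first. -/
noncomputable def nestedSum : List ℕ+ → ℕ → ℝ
  | [], _ => 1
  | k :: l, m => ∑ n ∈ Finset.range m, nestedSum l n / (n : ℝ) ^ (k : ℕ)

/-- The power series coefficients of the multiple polylogarithm of the word `k :: l`. -/
noncomputable def polylogCoeff (k : ℕ+) (l : List ℕ+) (n : ℕ) : ℝ :=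
  nestedSum l n / (n : ℝ) ^ (k : ℕ)

/-- The multiple polylogarithm of a word, as a function of a real variable. -/
noncomputable def wordPolylog : List ℕ+ → ℝ → ℝ
  | [], _ => 1
  | k :: l, x => ∑' n, polylogCoeff k l n * x ^ n

lemma nestedSum_cons (k : ℕ+) (l : List ℕ+) (m : ℕ) :
    nestedSum (k :: l) m = ∑ n ∈ Finset.range m, polylogCoeff k l n := rfl

lemma nestedSum_cons_succ (k : ℕ+) (l : List ℕ+) (m : ℕ) :
    nestedSum (k :: l) (m + 1) = nestedSum (k :: l) m + polylogCoeff k l m := by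
  rw [nestedSum_cons, Finset.sum_range_succ, nestedSum_cons]

lemma nestedSum_cons_zero (k : ℕ+) (l : List ℕ+) : nestedSum (k :: l) 0 = 0 := by
  simp [nestedSum_cons]

/-- Sums over `range` include the index 0, which is no summation index of the series; division by
zero makes its term vanish. -/
lemma polylogCoeff_zero (k : ℕ+) (l : List ℕ+) : polylogCoeff k l 0 = 0 := by
  simp [polylogCoeff]

lemma nestedSum_nonneg (l : List ℕ+) (m : ℕ) : 0 ≤ nestedSum l m := by
  induction l generalizing m with
  | nil => simp [nestedSum]
  | cons k l ih => exact Finset.sum_nonneg fun n _ => div_nonneg (ih n) (by positivity)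

lemma polylogCoeff_nonneg (k : ℕ+) (l : List ℕ+) (n : ℕ) : 0 ≤ polylogCoeff k l n :=
  div_nonneg (nestedSum_nonneg l n) (by positivity)

lemma polylogCoeff_le_div (k : ℕ+) (l : List ℕ+) (n : ℕ) :
    polylogCoeff k l n ≤ nestedSum l n / n := by
  rcases Nat.eq_zero_or_pos n with rfl | hn
  · simp [polylogCoeff]
  · have h1 : (1 : ℝ) ≤ n := by exact_mod_cast hn
    exact div_le_div_of_nonneg_left (nestedSum_nonneg l n) (by positivity)
      (le_self_pow₀ h1 k.pos.ne')

/-- Each summand is at most 1, by the same bound one depth lower. This crude linear bound is enough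
wherever only a power series in the unit disc or a far right half-plane is involved. -/
lemma nestedSum_le (l : List ℕ+) {m : ℕ} (hm : 1 ≤ m) : nestedSum l m ≤ m := by
  induction l generalizing m with
  | nil => simpa [nestedSum] using hm
  | cons k l ih =>
    rw [nestedSum_cons]
    calc _ ≤ ∑ n ∈ Finset.range m, (1 : ℝ) := by
          refine Finset.sum_le_sum fun n _ => ?_
          rcases Nat.eq_zero_or_pos n with rfl | hn
          · simp [polylogCoeff_zero]
          · exact (polylogCoeff_le_div k l n).trans
              (div_le_one_of_le₀ (ih hn) (Nat.cast_nonneg n))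
      _ = m := by simp

lemma polylogCoeff_le_one (k : ℕ+) (l : List ℕ+) (n : ℕ) : polylogCoeff k l n ≤ 1 := by
  rcases Nat.eq_zero_or_pos n with rfl | hn
  · simp [polylogCoeff_zero]
  · exact (polylogCoeff_le_div k l n).trans
      (div_le_one_of_le₀ (nestedSum_le l hn) (Nat.cast_nonneg n))

lemma abs_polylogCoeff_le_one (k : ℕ+) (l : List ℕ+) (n : ℕ) : |polylogCoeff k l n| ≤ 1 := by
  rw [abs_of_nonneg (polylogCoeff_nonneg k l n)]
  exact polylogCoeff_le_one k l n

lemma summable_mul_pow_of_abs_le_one {a : ℕ → ℝ} (ha : ∀ n, |a n| ≤ 1) {x : ℝ} (hx : |x| < 1) :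
    Summable fun n => a n * x ^ n := by
  refine Summable.of_norm_bounded (summable_geometric_of_lt_one (abs_nonneg x) hx) fun n => ?_
  rw [Real.norm_eq_abs, abs_mul, abs_pow]
  exact mul_le_of_le_one_left (by positivity) (ha n)

lemma summable_polylog (k : ℕ+) (l : List ℕ+) {x : ℝ} (hx : |x| < 1) :
    Summable fun n => polylogCoeff k l n * x ^ n :=
  summable_mul_pow_of_abs_le_one (abs_polylogCoeff_le_one k l) hx

lemma hasDerivAt_tsum_mul_pow {a : ℕ → ℝ} (ha : ∀ n, |a n| ≤ 1) {x : ℝ} (hx : |x| < 1) :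
    HasDerivAt (fun x => ∑' n, a n * x ^ n) (∑' n, a n * (n * x ^ (n - 1))) x := by
  obtain ⟨ρ, hxρ, hρ⟩ := exists_between hx
  have hρ0 : 0 < ρ := (abs_nonneg x).trans_lt hxρ
  have hu : Summable fun n : ℕ => (n : ℝ) * ρ ^ (n - 1) := by
    have h := (summable_pow_mul_geometric_of_norm_lt_one (R := ℝ) 1
      (r := ρ) (by rwa [Real.norm_eq_abs, abs_of_pos hρ0])).mul_left (ρ⁻¹)
    refine h.congr fun n => ?_
    rcases n with _ | n
    · simp
    · simp only [Nat.add_sub_cancel, pow_succ]; field_simp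
  refine hasDerivAt_tsum_of_isPreconnected (t := Metric.ball 0 ρ) (y₀ := 0) hu Metric.isOpen_ball
    (convex_ball _ _).isPreconnected (fun n y _ => (hasDerivAt_pow n y).const_mul (a n))
    (fun n y hy => ?_) (by simpa using hρ0)
    (summable_mul_pow_of_abs_le_one ha (by simp)) (by simpa using hxρ)
  have hy' : |y| ≤ ρ := by simpa using (mem_ball_zero_iff.1 hy).le
  rw [Real.norm_eq_abs, abs_mul, abs_mul, abs_pow, Nat.abs_cast]
  exact (mul_le_of_le_one_left (by positivity) (ha n)).trans (by gcongr)

/-- Termwise differentiation cancels one power of the largest index. Since that index carries the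
head letter, only the head changes; this is why words are written in reverse. -/
lemma hasDerivAt_wordPolylog_succ (k : ℕ+) (l : List ℕ+) {x : ℝ} (hx : |x| < 1) (hx0 : x ≠ 0) :
    HasDerivAt (wordPolylog ((k + 1) :: l)) (wordPolylog (k :: l) x / x) x := by
  have h := hasDerivAt_tsum_mul_pow (abs_polylogCoeff_le_one (k + 1) l) hx
  convert! h using 1
  rw [wordPolylog, ← tsum_div_const]
  refine tsum_congr fun n => ?_
  rcases n with _ | n
  · simp [polylogCoeff_zero]
  · simp only [polylogCoeff, PNat.add_coe, PNat.one_coe, Nat.add_sub_cancel, pow_succ]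
    have : ((n + 1 : ℕ) : ℝ) ≠ 0 := by positivity
    field_simp

lemma summable_nestedSum_mul_pow (l : List ℕ+) {x : ℝ} (hx : |x| < 1) :
    Summable fun n => nestedSum l (n + 1) * x ^ n := by
  have hs : Summable fun n : ℕ => ((n : ℝ) + 1) * |x| ^ n := by
    have h1 := summable_pow_mul_geometric_of_norm_lt_one (R := ℝ) 1 (r := |x|) (by simpa using hx)
    have h2 := summable_geometric_of_lt_one (abs_nonneg x) hx
    refine (h1.add h2).congr fun n => by ring
  refine Summable.of_norm_bounded hs fun n => ?_
  rw [Real.norm_eq_abs, abs_mul, abs_pow, abs_of_nonneg (nestedSum_nonneg _ _)]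
  gcongr
  exact_mod_cast nestedSum_le l (Nat.succ_pos n)

/-- The nested sums are the partial sums of the polylogarithm coefficients, so their generating
function S satisfies S = x S + Li. It serves both the derivative of words with head 1 and the
Dirichlet series of the zeta kernel. -/
lemma tsum_nestedSum_mul_pow (l : List ℕ+) {x : ℝ} (hx : |x| < 1) :
    ∑' n, nestedSum l (n + 1) * x ^ n = wordPolylog l x / (1 - x) := by
  have hx1 : 1 - x ≠ 0 := by have := (abs_lt.1 hx).2; linarith
  rcases l with _ | ⟨k, l⟩
  · simp only [nestedSum, wordPolylog, one_mul]
    rw [tsum_geometric_of_abs_lt_one hx, one_div]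
  · rw [eq_div_iff hx1]
    have hs := summable_nestedSum_mul_pow (k :: l) hx
    have h0 : ∑' n, nestedSum (k :: l) n * x ^ n = x * ∑' n, nestedSum (k :: l) (n + 1) * x ^ n := by
      have hs' : Summable fun n => nestedSum (k :: l) n * x ^ n :=
        (summable_nat_add_iff 1).1 ((hs.mul_left x).congr fun n => by ring)
      rw [hs'.tsum_eq_zero_add, nestedSum_cons_zero, zero_mul, zero_add, ← tsum_mul_left]
      exact tsum_congr fun n => by ring
    have h1 : ∑' n, nestedSum (k :: l) (n + 1) * x ^ n
        = ∑' n, nestedSum (k :: l) n * x ^ n + wordPolylog (k :: l) x := by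
      have hs' : Summable fun n => nestedSum (k :: l) n * x ^ n :=
        (summable_nat_add_iff 1).1 ((hs.mul_left x).congr fun n => by ring)
      rw [wordPolylog, ← hs'.tsum_add (summable_polylog k l hx)]
      exact tsum_congr fun n => by rw [nestedSum_cons_succ]; ring
    linarith [h0, h1]

lemma hasDerivAt_wordPolylog_one (l : List ℕ+) {x : ℝ} (hx : |x| < 1) :
    HasDerivAt (wordPolylog (1 :: l)) (wordPolylog l x / (1 - x)) x := by
  have h := hasDerivAt_tsum_mul_pow (abs_polylogCoeff_le_one 1 l) hx
  convert! h using 1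
  rw [← tsum_nestedSum_mul_pow l hx]
  have hs := summable_nestedSum_mul_pow l hx
  have he : ∀ n : ℕ, polylogCoeff 1 l (n + 1) * (((n + 1 : ℕ) : ℝ) * x ^ (n + 1 - 1))
      = nestedSum l (n + 1) * x ^ n := fun n => by
    have : ((n + 1 : ℕ) : ℝ) ≠ 0 := by positivity
    simp only [polylogCoeff, PNat.one_coe, pow_one, Nat.add_sub_cancel]
    field_simp
  rw [Summable.tsum_eq_zero_add ((summable_nat_add_iff (f := fun n : ℕ =>
    polylogCoeff 1 l n * ((n : ℝ) * x ^ (n - 1))) 1).1 (hs.congr fun n => (he n).symm))]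
  simp only [he]
  simp

lemma wordPolylog_cons_zero (k : ℕ+) (l : List ℕ+) : wordPolylog (k :: l) 0 = 0 := by
  rw [wordPolylog]
  refine (tsum_congr fun n => ?_).trans tsum_zero
  rcases n with _ | n
  · simp [polylogCoeff_zero]
  · simp

lemma wordPolylog_nonneg (l : List ℕ+) {x : ℝ} (hx : 0 ≤ x) : 0 ≤ wordPolylog l x := by
  rcases l with _ | ⟨k, l⟩
  · simp [wordPolylog]
  · exact tsum_nonneg fun n => mul_nonneg (polylogCoeff_nonneg k l n) (by positivity)

lemma wordPolylog_cons_le (k : ℕ+) (l : List ℕ+) {x : ℝ} (hx0 : 0 ≤ x) (hx : x < 1) :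
    wordPolylog (k :: l) x ≤ x / (1 - x) := by
  have hx' : |x| < 1 := by rwa [abs_of_nonneg hx0]
  rw [wordPolylog, (summable_polylog k l hx').tsum_eq_zero_add, polylogCoeff_zero, zero_mul,
    zero_add, div_eq_mul_inv, ← tsum_geometric_of_abs_lt_one hx', ← tsum_mul_left]
  refine Summable.tsum_le_tsum (fun n => ?_)
    ((summable_nat_add_iff 1).2 (summable_polylog k l hx'))
    ((summable_geometric_of_lt_one hx0 hx).mul_left x)
  rw [pow_succ']
  exact mul_le_of_le_one_left (by positivity) (polylogCoeff_le_one _ _ _)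

lemma differentiableAt_wordPolylog (l : List ℕ+) {x : ℝ} (hx : |x| < 1) :
    DifferentiableAt ℝ (wordPolylog l) x := by
  rcases l with _ | ⟨k, l⟩
  · exact differentiableAt_const (1 : ℝ)
  · exact (hasDerivAt_tsum_mul_pow (abs_polylogCoeff_le_one k l) hx).differentiableAt

lemma wordPolylog_singleton_one {x : ℝ} (hx : |x| < 1) : wordPolylog [1] x = -Real.log (1 - x) := by
  rw [← (Real.hasSum_pow_div_log_of_abs_lt_one hx).tsum_eq, wordPolylog,
    (summable_polylog 1 [] hx).tsum_eq_zero_add]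
  simp only [polylogCoeff_zero, zero_mul, zero_add]
  refine tsum_congr fun n => ?_
  simp only [polylogCoeff, nestedSum, PNat.one_coe, pow_one]
  push_cast
  ring

/-! ### Shuffle product with the letter 1 -/

/-- The weight of a word. -/
def wordWeight (w : List ℕ+) : ℕ := (w.map fun a : ℕ+ => (a : ℕ)).sum

@[simp] lemma wordWeight_nil : wordWeight [] = 0 := rfl

@[simp] lemma wordWeight_cons (k : ℕ+) (l : List ℕ+) :
    wordWeight (k :: l) = k + wordWeight l := by simp [wordWeight]

/-- Increase the first letter of a word. -/
def bumpHead : List ℕ+ → List ℕ+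
  | [] => []
  | k :: l => (k + 1) :: l

/-- Derivatives are compared only on the open interval, because the rule for a head above 1 divides
by x; continuity reaches the endpoint 0. -/
lemma eqOn_of_hasDerivAt_eq {f g f' : ℝ → ℝ} (hf : ∀ x ∈ Ico (0 : ℝ) 1, ContinuousAt f x)
    (hg : ∀ x ∈ Ico (0 : ℝ) 1, ContinuousAt g x)
    (hf' : ∀ x ∈ Ioo (0 : ℝ) 1, HasDerivAt f (f' x) x)
    (hg' : ∀ x ∈ Ioo (0 : ℝ) 1, HasDerivAt g (f' x) x) (h0 : f 0 = g 0) :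
    ∀ x ∈ Ico (0 : ℝ) 1, f x = g x := by
  intro x hx
  rcases hx.1.eq_or_lt with rfl | hx0
  · exact h0
  have hsub : Icc 0 x ⊆ Ico (0 : ℝ) 1 := Icc_subset_Ico_right hx.2
  have hsub' : Ioo 0 x ⊆ Ioo (0 : ℝ) 1 := Ioo_subset_Ioo_right hx.2.le
  obtain ⟨c, hc, hc'⟩ := exists_hasDerivAt_eq_slope (fun x => f x - g x) (fun _ => 0) hx0
    (fun y hy => ((hf y (hsub hy)).sub (hg y (hsub hy))).continuousWithinAt)
    (fun y hy => by simpa using (hf' y (hsub' hy)).fun_sub (hg' y (hsub' hy)))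
  have := hc'.symm
  simp only [h0, sub_self, sub_zero] at this
  rcases div_eq_zero_iff.1 this with h | h <;> linarith

/-- The sum of the polylogarithms of a list of words. -/
noncomputable def polylogSum (I : List (List ℕ+)) (x : ℝ) : ℝ :=
  (I.map fun w => wordPolylog w x).sum

lemma hasDerivAt_polylogSum_map {I : List (List ℕ+)} {φ : List ℕ+ → List ℕ+} {x d : ℝ}
    (h : ∀ w ∈ I, HasDerivAt (wordPolylog (φ w)) (wordPolylog w x * d) x) :
    HasDerivAt (polylogSum (I.map φ)) (polylogSum I x * d) x := by
  induction I with
  | nil =>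
    convert! hasDerivAt_const x (0 : ℝ) using 1
    simp [polylogSum]
  | cons w I ih =>
    have h1 := (h w (by simp)).add (ih fun v hv => h v (by simp [hv]))
    convert! h1 using 1
    simp [polylogSum, add_mul]

lemma continuousAt_polylogSum (I : List (List ℕ+)) {x : ℝ} (hx : |x| < 1) :
    ContinuousAt (polylogSum I) x := by
  induction I with
  | nil => exact continuousAt_const (y := (0 : ℝ))
  | cons w I ih => exact (differentiableAt_wordPolylog w hx).continuousAt.add ih

lemma polylogSum_zero {I : List (List ℕ+)} (h : ∀ w ∈ I, w ≠ []) : polylogSum I 0 = 0 := by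
  refine List.sum_eq_zero fun y hy => ?_
  obtain ⟨w, hw, rfl⟩ := List.mem_map.1 hy
  obtain ⟨k, l, rfl⟩ := List.exists_cons_of_ne_nil (h w hw)
  exact wordPolylog_cons_zero k l

/-- By the product rule, the derivative of the left side is 1/(1 - x) times the sum of Li_(1w) and
the product assumed known. Integrating prefixes every word with a 1, and the extra Li_(1w) raises
the multiplicity c by one. -/
lemma wordPolylog_one_mul_cons_one {c : ℝ} {w : List ℕ+} {I : List (List ℕ+)}
    (h : ∀ x ∈ Ico (0 : ℝ) 1, wordPolylog [1] x * wordPolylog w x =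
      c * wordPolylog (1 :: w) x + polylogSum I x) :
    ∀ x ∈ Ico (0 : ℝ) 1, wordPolylog [1] x * wordPolylog (1 :: w) x =
      (c + 1) * wordPolylog (1 :: 1 :: w) x + polylogSum (I.map (List.cons 1)) x := by
  have habs : ∀ x ∈ Ico (0 : ℝ) 1, |x| < 1 := fun x hx => by
    rw [abs_of_nonneg hx.1]; exact hx.2
  refine eqOn_of_hasDerivAt_eq (f' := fun x => (c + 1) * (wordPolylog (1 :: w) x / (1 - x)) +
    polylogSum I x * (1 - x)⁻¹) (fun x hx => ?_) (fun x hx => ?_) (fun x hx => ?_)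
    (fun x hx => ?_) ?_
  · exact (differentiableAt_wordPolylog _ (habs x hx)).continuousAt.mul
      (differentiableAt_wordPolylog _ (habs x hx)).continuousAt
  · exact ((differentiableAt_wordPolylog _ (habs x hx)).continuousAt.const_mul _).add
      (continuousAt_polylogSum _ (habs x hx))
  · have hx' := habs x (Ioo_subset_Ico_self hx)
    convert! (hasDerivAt_wordPolylog_one [] hx').mul (hasDerivAt_wordPolylog_one w hx') using 1
    have := h x (Ioo_subset_Ico_self hx)
    rw [show wordPolylog [] x = 1 from rfl]
    linear_combination -(1 - x)⁻¹ * this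
  · have hx' := habs x (Ioo_subset_Ico_self hx)
    exact ((hasDerivAt_wordPolylog_one (1 :: w) hx').const_mul _).add
      (hasDerivAt_polylogSum_map fun w _ => hasDerivAt_wordPolylog_one w hx')
  · simp [polylogSum_zero, wordPolylog_cons_zero]

/-- The shuffle recursion for a word whose first differential form is dx/x: one term of the product
rule carries 1/(1 - x) and prefixes a 1, the other carries 1/x and raises heads. Words in `I` must
be nonempty to have a head. -/
lemma wordPolylog_one_mul_succ {k : ℕ+} {l : List ℕ+} {I : List (List ℕ+)}
    (hI : ∀ v ∈ I, v ≠ [])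
    (h : ∀ x ∈ Ico (0 : ℝ) 1, wordPolylog [1] x * wordPolylog (k :: l) x = polylogSum I x) :
    ∀ x ∈ Ico (0 : ℝ) 1, wordPolylog [1] x * wordPolylog ((k + 1) :: l) x =
      wordPolylog (1 :: (k + 1) :: l) x + polylogSum (I.map bumpHead) x := by
  have habs : ∀ x ∈ Ico (0 : ℝ) 1, |x| < 1 := fun x hx => by
    rw [abs_of_nonneg hx.1]; exact hx.2
  have hne : ∀ v ∈ I.map bumpHead, v ≠ [] := by
    simp only [List.mem_map]
    rintro v ⟨u, hu, rfl⟩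
    obtain ⟨a, u, rfl⟩ := List.exists_cons_of_ne_nil (hI u hu)
    simp [bumpHead]
  refine eqOn_of_hasDerivAt_eq (f' := fun x => wordPolylog ((k + 1) :: l) x / (1 - x) +
    polylogSum I x * x⁻¹) (fun x hx => ?_) (fun x hx => ?_) (fun x hx => ?_)
    (fun x hx => ?_) ?_
  · exact (differentiableAt_wordPolylog _ (habs x hx)).continuousAt.mul
      (differentiableAt_wordPolylog _ (habs x hx)).continuousAt
  · exact (differentiableAt_wordPolylog _ (habs x hx)).continuousAt.add
      (continuousAt_polylogSum _ (habs x hx))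
  · have hx' := habs x (Ioo_subset_Ico_self hx)
    convert! (hasDerivAt_wordPolylog_one [] hx').mul
      (hasDerivAt_wordPolylog_succ k l hx' hx.1.ne') using 1
    rw [← h x (Ioo_subset_Ico_self hx), show wordPolylog [] x = 1 from rfl]
    ring
  · have hx' := habs x (Ioo_subset_Ico_self hx)
    refine (hasDerivAt_wordPolylog_one ((k + 1) :: l) hx').add
      (hasDerivAt_polylogSum_map fun w hw => ?_)
    obtain ⟨a, u, rfl⟩ := List.exists_cons_of_ne_nil (hI w hw)
    exact hasDerivAt_wordPolylog_succ a u hx' hx.1.ne'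
  · simp [polylogSum_zero hne, wordPolylog_cons_zero]

/-- The shuffle product of a word with the one-letter word of weight one. -/
lemma exists_shuffle_one (w : List ℕ+) : ∃ I : List (List ℕ+),
    (∀ v ∈ I, v ≠ [] ∧ wordWeight v = wordWeight w + 1) ∧
      ∀ x ∈ Ico (0 : ℝ) 1, wordPolylog [1] x * wordPolylog w x = polylogSum I x := by
  induction w with
  | nil => exact ⟨[[1]], by simp, fun x _ => by simp [polylogSum, wordPolylog]⟩
  | cons k l ih =>
    -- A head equal to 1 falls back on the tail, a larger head on its predecessor with the same
    -- tail.
    induction k using PNat.recOn with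
    | one =>
      obtain ⟨I, hI, hI'⟩ := ih
      refine ⟨(1 :: 1 :: l) :: I.map (List.cons 1), ?_, fun x hx => ?_⟩
      · simp only [List.mem_cons, List.mem_map]
        rintro v (rfl | ⟨u, hu, rfl⟩)
        · simp; omega
        · simp [(hI u hu).2]; omega
      · rw [wordPolylog_one_mul_cons_one (c := 0) (fun x hx => by rw [hI' x hx]; ring) x hx]
        simp [polylogSum]
    | succ k ihk =>
      obtain ⟨I, hI, hI'⟩ := ihk
      refine ⟨(1 :: (k + 1) :: l) :: I.map bumpHead, ?_, fun x hx => ?_⟩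
      · simp only [List.mem_cons, List.mem_map]
        rintro v (rfl | ⟨u, hu, rfl⟩)
        · simp; omega
        · obtain ⟨a, u, rfl⟩ := List.exists_cons_of_ne_nil (hI u hu).1
          have := (hI _ hu).2
          simp [bumpHead] at this ⊢; omega
      · rw [wordPolylog_one_mul_succ (fun v hv => (hI v hv).1) hI' x hx]
        simp [polylogSum]

/-! ### From sums over increasing tuples to nested sums -/

/-- Forget the last entry of a strictly increasing tuple. -/
def tupleInit {n : ℕ} (f : Fin (n + 1) ↪o ℕ+) : Fin n ↪o ℕ+ := Fin.castSuccOrderEmb.trans f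

@[simp] lemma tupleInit_apply {n : ℕ} (f : Fin (n + 1) ↪o ℕ+) (i : Fin n) :
    tupleInit f i = f i.castSucc := rfl

/-- Append a new last entry to a strictly increasing tuple. -/
def tupleSnoc {n : ℕ} (m : ℕ+) (f : Fin n ↪o ℕ+) (hf : ∀ i, (f i : ℕ) < (m : ℕ)) :
    Fin (n + 1) ↪o ℕ+ :=
  OrderEmbedding.ofStrictMono (Fin.snoc (α := fun _ => ℕ+) f m) (by
    intro i j hij
    induction j using Fin.lastCases with
    | last =>
      induction i using Fin.lastCases with
      | last => exact absurd hij (lt_irrefl _)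
      | cast i => simpa using hf i
    | cast j =>
      induction i using Fin.lastCases with
      | last => exact absurd (hij.trans (Fin.castSucc_lt_last j)) (lt_irrefl _)
      | cast i => simpa using hij)

@[simp] lemma tupleSnoc_castSucc {n : ℕ} (m : ℕ+) (f : Fin n ↪o ℕ+)
    (hf : ∀ i, (f i : ℕ) < (m : ℕ)) (i : Fin n) : tupleSnoc m f hf i.castSucc = f i :=
  Fin.snoc_castSucc (α := fun _ => ℕ+) _ _ _

@[simp] lemma tupleSnoc_last {n : ℕ} (m : ℕ+) (f : Fin n ↪o ℕ+)
    (hf : ∀ i, (f i : ℕ) < (m : ℕ)) : tupleSnoc m f hf (Fin.last n) = m :=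
  Fin.snoc_last (α := fun _ => ℕ+) _ _

/-- A strictly increasing tuple consists of its last entry and of a shorter tuple below it. -/
def tupleEquiv (n : ℕ) :
    (Fin (n + 1) ↪o ℕ+) ≃ Σ m : ℕ+, {f : Fin n ↪o ℕ+ // ∀ i, (f i : ℕ) < (m : ℕ)} where
  toFun f := ⟨f (Fin.last n), tupleInit f, fun i =>
    f.strictMono (Fin.castSucc_lt_last i)⟩
  invFun p := tupleSnoc p.1 p.2.1 p.2.2
  left_inv f := by
    ext i
    induction i using Fin.lastCases <;> simp
  right_inv p := by
    obtain ⟨m, f, hf⟩ := p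
    have h : ∀ (m' : ℕ+) (f' : Fin n ↪o ℕ+) (hf' : ∀ i, (f' i : ℕ) < (m' : ℕ)), m' = m → f' = f →
        (⟨m', f', hf'⟩ : Σ m : ℕ+, {f : Fin n ↪o ℕ+ // ∀ i, (f i : ℕ) < (m : ℕ)}) =
          ⟨m, f, hf⟩ := by
      rintro _ _ _ rfl rfl
      rfl
    exact h _ _ _ (tupleSnoc_last m f hf) (by ext i; simp)

instance finite_tuple_lt (n m : ℕ) : Finite {f : Fin n ↪o ℕ+ // ∀ i, (f i : ℕ) < m} := by
  refine Finite.of_injective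
    (fun f : {f : Fin n ↪o ℕ+ // ∀ i, (f i : ℕ) < m} => fun i => (⟨f.1 i, f.2 i⟩ : Fin m)) ?_
  intro f g h
  ext i
  simpa using congrArg Fin.val (congrFun h i)

section
variable {E : Type*} [NormedAddCommGroup E] [NormedSpace ℝ E] [CompleteSpace E]

/-- Fubini over the last entry: for a fixed last entry there are finitely many shorter tuples, and
nonnegative weights reduce absolute convergence to the single sum `hs`. -/
lemma hasSum_tuple {n : ℕ} {p : (Fin n ↪o ℕ+) → ℝ} (hp : ∀ f, 0 ≤ p f) {G : ℕ+ → E}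
    (hs : Summable fun m : ℕ+ =>
      (∑' f : {f : Fin n ↪o ℕ+ // ∀ i, (f i : ℕ) < (m : ℕ)}, p f) * ‖G m‖) :
    HasSum (fun f : Fin (n + 1) ↪o ℕ+ => p (tupleInit f) • G (f (Fin.last n)))
      (∑' m : ℕ+, (∑' f : {f : Fin n ↪o ℕ+ // ∀ i, (f i : ℕ) < (m : ℕ)}, p f) • G m) := by
  set F : (Σ m : ℕ+, {f : Fin n ↪o ℕ+ // ∀ i, (f i : ℕ) < (m : ℕ)}) → E :=
    fun q => p q.2.1 • G q.1 with hF
  have hsum : Summable F := by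
    refine Summable.of_norm ((summable_sigma_of_nonneg fun q => norm_nonneg _).2
      ⟨fun m => Summable.of_finite, ?_⟩)
    refine hs.congr fun m => ?_
    rw [← tsum_mul_right]
    refine tsum_congr fun f => ?_
    simp [hF, norm_smul, abs_of_nonneg (hp _)]
  have h1 : HasSum F (∑' m : ℕ+,
      (∑' f : {f : Fin n ↪o ℕ+ // ∀ i, (f i : ℕ) < (m : ℕ)}, p f) • G m) := by
    have h2 := hsum.hasSum
    rw [hsum.tsum_sigma] at h2
    convert! h2 using 1
    refine tsum_congr fun m => ?_
    simp only [hF]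
    have hsf : Summable fun f : {f : Fin n ↪o ℕ+ // ∀ i, (f i : ℕ) < (m : ℕ)} => p f :=
      Summable.of_finite
    exact (hsf.tsum_smul_const (G m)).symm
  exact (Equiv.hasSum_iff (tupleEquiv n)).2 h1

end

/-- The product `1 / (m₁ ^ k₁ ⋯ m_n ^ k_n)`. -/
noncomputable def tupleProd {n : ℕ} (κ : Fin n → ℕ+) (f : Fin n ↪o ℕ+) : ℝ :=
  ∏ i, 1 / ((f i : ℕ) : ℝ) ^ (κ i : ℕ)

lemma tupleProd_nonneg {n : ℕ} (κ : Fin n → ℕ+) (f : Fin n ↪o ℕ+) : 0 ≤ tupleProd κ f :=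
  Finset.prod_nonneg fun i _ => by positivity

lemma tupleProd_succ {n : ℕ} (κ : Fin (n + 1) → ℕ+) (f : Fin (n + 1) ↪o ℕ+) :
    tupleProd κ f = tupleProd (fun i => κ i.castSucc) (tupleInit f) *
      (1 / ((f (Fin.last n) : ℕ) : ℝ) ^ (κ (Fin.last n) : ℕ)) := by
  rw [tupleProd, Fin.prod_univ_castSucc]
  rfl

lemma hasSum_pnat_iff_of_zero {E : Type*} [NormedAddCommGroup E] {g : ℕ → E} (hg : g 0 = 0) {a : E} :
    HasSum (fun m : ℕ+ => g m) a ↔ HasSum g a := by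
  refine PNat.coe_injective.hasSum_iff (f := g) fun m hm => ?_
  rcases Nat.eq_zero_or_pos m with rfl | h
  · exact hg
  · exact absurd ⟨⟨m, h⟩, rfl⟩ hm

lemma tsum_tupleProd {n : ℕ} (κ : Fin n → ℕ+) (m : ℕ) :
    ∑' f : {f : Fin n ↪o ℕ+ // ∀ i, (f i : ℕ) < m}, tupleProd κ f =
      nestedSum (List.ofFn κ).reverse m := by
  induction n generalizing m with
  | zero =>
    have : Unique {f : Fin 0 ↪o ℕ+ // ∀ i, (f i : ℕ) < m} :=
      { default := ⟨OrderEmbedding.ofIsEmpty, fun i => i.elim0⟩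
        uniq := fun f => Subtype.ext (by ext i; exact i.elim0) }
    rw [tsum_eq_single default fun f hf => absurd (Unique.eq_default f) hf]
    simp [tupleProd, nestedSum]
  | succ n ih =>
    have hw : (List.ofFn κ).reverse =
        κ (Fin.last n) :: (List.ofFn fun i : Fin n => κ i.castSucc).reverse := by
      rw [List.ofFn_succ', List.concat_eq_append, List.reverse_append]
      rfl
    rw [hw, nestedSum_cons]
    set l := (List.ofFn fun i : Fin n => κ i.castSucc).reverse with hl
    set k := κ (Fin.last n)
    -- Cutting off the last factor at m encodes the bound on the whole tuple, since the last entry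
    -- is the largest; the sum then runs over all tuples.
    set G : ℕ → ℝ := fun x => if x < m then 1 / (x : ℝ) ^ (k : ℕ) else 0 with hG
    have hfin : ∀ φ : ℕ → ℝ → ℝ, (∀ x, φ x 0 = 0) → HasSum (fun x => φ x (G x))
        (∑ x ∈ Finset.range m, φ x (G x)) := fun φ hφ =>
      hasSum_sum_of_ne_finset_zero fun x hx => by
        rw [Finset.mem_range] at hx
        simp [hG, hx, hφ]
    have hG0 : G 0 = 0 := by simp [hG]
    have hs : HasSum (fun x : ℕ+ => nestedSum l x * ‖G x‖) _ :=
      (hasSum_pnat_iff_of_zero (g := fun x => nestedSum l x * ‖G x‖) (by simp [hG0])).2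
        (hfin (fun x y => nestedSum l x * ‖y‖) (by simp))
    have hs' : HasSum (fun x : ℕ+ => nestedSum l x • G x) _ :=
      (hasSum_pnat_iff_of_zero (g := fun x => nestedSum l x • G x) (by simp [hG0])).2
        (hfin (fun x y => nestedSum l x • y) (by simp))
    have h := hasSum_tuple (p := tupleProd fun i : Fin n => κ i.castSucc) (tupleProd_nonneg _)
      (G := fun x : ℕ+ => G x) (by simpa only [ih] using hs.summable)
    simp only [ih] at h
    rw [hs'.tsum_eq] at h
    have hind : ∀ f : Fin (n + 1) ↪o ℕ+,
        {f : Fin (n + 1) ↪o ℕ+ | ∀ i, (f i : ℕ) < m}.indicator (tupleProd κ) f =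
          tupleProd (fun i : Fin n => κ i.castSucc) (tupleInit f) • G (f (Fin.last n)) := fun f => by
      have hiff : (∀ i, (f i : ℕ) < m) ↔ (f (Fin.last n) : ℕ) < m :=
        ⟨fun h => h _, fun h i => lt_of_le_of_lt (f.monotone (Fin.le_last i)) h⟩
      by_cases hf : (f (Fin.last n) : ℕ) < m
      · rw [indicator_of_mem (show f ∈ {f : Fin (n + 1) ↪o ℕ+ | ∀ i, (f i : ℕ) < m} from hiff.2 hf),
          tupleProd_succ]
        simp only [hG, if_pos hf, smul_eq_mul]
        rfl
      · rw [indicator_of_notMem (show f ∉ {f : Fin (n + 1) ↪o ℕ+ | ∀ i, (f i : ℕ) < m} from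
          fun h => hf (hiff.1 h))]
        simp [hG, if_neg hf]
    have h3 := tsum_subtype {f : Fin (n + 1) ↪o ℕ+ | ∀ i, (f i : ℕ) < m} (tupleProd κ)
    refine h3.trans ?_
    simp only [hind]
    rw [h.tsum_eq]
    refine Finset.sum_congr rfl fun x hx => ?_
    simp [hG, Finset.mem_range.1 hx, polylogCoeff, div_eq_mul_inv]

lemma ofFn_get_reverse (l : MZIndex) : (List.ofFn l.get).reverse = l.reverse := by
  rw [List.ofFn_get]

section
variable {E : Type*} [NormedAddCommGroup E] [NormedSpace ℝ E] [CompleteSpace E]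

lemma hasSum_tupleProd_smul (l : MZIndex) {G : ℕ → E} (h0 : G 0 = 0)
    (hs : Summable fun m => nestedSum l.reverse m * ‖G m‖) :
    HasSum (fun f : Fin (l.length + 1) ↪o ℕ+ =>
        tupleProd l.get (tupleInit f) • G (f (Fin.last l.length)))
      (∑' m, nestedSum l.reverse m • G m) := by
  have hp := (hasSum_pnat_iff_of_zero (g := fun m => nestedSum l.reverse m * ‖G m‖) (by simp [h0])).2
    hs.hasSum
  have hs2 : Summable fun m => nestedSum l.reverse m • G m :=
    Summable.of_norm (hs.congr fun m => by
      rw [norm_smul, Real.norm_eq_abs, abs_of_nonneg (nestedSum_nonneg _ _)])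
  have hp2 := (hasSum_pnat_iff_of_zero (g := fun m => nestedSum l.reverse m • G m) (by simp [h0])).2
    hs2.hasSum
  have h := hasSum_tuple (p := tupleProd l.get) (tupleProd_nonneg _) (G := fun m : ℕ+ => G m)
    (by simpa only [tsum_tupleProd, ofFn_get_reverse] using hp.summable)
  simp only [tsum_tupleProd, ofFn_get_reverse] at h
  rwa [hp2.tsum_eq] at h

end

/-- The type of `get` depends on the length of the list, and the length of `l ++ [a]` is not
syntactically a successor; equality of pairs lets both be rewritten at once. -/
lemma sigma_get_append (l : MZIndex) (a : ℕ+) :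
    (⟨(l ++ [a]).length, (l ++ [a]).get⟩ : Σ n, Fin n → ℕ+) =
      ⟨l.length + 1, Fin.snoc (α := fun _ => ℕ+) l.get a⟩ := by
  apply (List.equivSigmaTuple (α := ℕ+)).symm.injective
  simp only [List.equivSigmaTuple, Equiv.coe_fn_symm_mk]
  rw [List.ofFn_get, List.ofFn_succ']
  simp

lemma multiPolylog_ofReal (l : MZIndex) (a : ℕ+) {x : ℝ} (hx : |x| < 1) :
    multiPolylog (l ++ [a]) x = wordPolylog (a :: l.reverse) x := by
  set Φ : (Σ n, Fin n → ℕ+) → ℂ := fun p => ∑' m : Fin p.1 ↪o ℕ+,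
    (x : ℂ) ^ (Finset.univ.sup fun i => (m i : ℕ)) / ∏ i, ((m i : ℕ) : ℂ) ^ (p.2 i : ℕ) with hΦ
  change Φ ⟨_, (l ++ [a]).get⟩ = _
  rw [sigma_get_append]
  have hterm : ∀ f : Fin (l.length + 1) ↪o ℕ+,
      (x : ℂ) ^ (Finset.univ.sup fun i => (f i : ℕ)) /
        ∏ i, ((f i : ℕ) : ℂ) ^ ((Fin.snoc (α := fun _ => ℕ+) l.get a : Fin (l.length + 1) → ℕ+) i : ℕ)
      = tupleProd l.get (tupleInit f) •
        (fun m : ℕ => ((x ^ m / (m : ℝ) ^ (a : ℕ) : ℝ) : ℂ)) (f (Fin.last l.length)) := fun f => by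
    have hsup : (Finset.univ.sup fun i => (f i : ℕ)) = f (Fin.last l.length) :=
      le_antisymm (Finset.sup_le fun i _ => f.monotone (Fin.le_last i))
        (Finset.le_sup (f := fun i => (f i : ℕ)) (Finset.mem_univ _))
    rw [hsup, Fin.prod_univ_castSucc]
    simp only [Fin.snoc_castSucc, Fin.snoc_last, Complex.real_smul, tupleProd, tupleInit_apply]
    push_cast
    simp only [Finset.prod_div_distrib, Finset.prod_const_one]
    rw [div_mul_div_comm, one_mul]
  simp only [hΦ, hterm]
  have hs := (summable_polylog a l.reverse (x := |x|) (by rwa [abs_abs]))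
  rw [(hasSum_tupleProd_smul l (G := fun m : ℕ => ((x ^ m / (m : ℝ) ^ (a : ℕ) : ℝ) : ℂ))
    (by simp) ?_).tsum_eq]
  · rw [wordPolylog, Complex.ofReal_tsum]
    refine tsum_congr fun m => ?_
    rw [Complex.real_smul, ← Complex.ofReal_mul, polylogCoeff]
    congr 1
    ring
  · refine hs.congr fun m => ?_
    rw [Complex.norm_real, Real.norm_eq_abs, abs_div, abs_pow, abs_of_nonneg
      (by positivity : (0 : ℝ) ≤ (m : ℝ) ^ (a : ℕ)), polylogCoeff]
    ring

lemma multiZetaValue_append (l : MZIndex) (a : ℕ+) (hs : Summable (polylogCoeff a l.reverse)) :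
    multiZetaValue (l ++ [a]) = ∑' n, polylogCoeff a l.reverse n := by
  set Φ : (Σ n, Fin n → ℕ+) → ℝ := fun p => ∑' m : Fin p.1 ↪o ℕ+,
    ∏ i, 1 / ((m i : ℕ) : ℝ) ^ (p.2 i : ℕ) with hΦ
  change Φ ⟨_, (l ++ [a]).get⟩ = _
  rw [sigma_get_append]
  have hterm : ∀ f : Fin (l.length + 1) ↪o ℕ+,
      ∏ i, 1 / ((f i : ℕ) : ℝ) ^
          ((Fin.snoc (α := fun _ => ℕ+) l.get a : Fin (l.length + 1) → ℕ+) i : ℕ)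
      = tupleProd l.get (tupleInit f) •
        (fun m : ℕ => 1 / (m : ℝ) ^ (a : ℕ)) (f (Fin.last l.length)) := fun f => by
    change tupleProd _ f = _
    rw [tupleProd_succ]
    simp only [Fin.snoc_castSucc, Fin.snoc_last, smul_eq_mul]
  simp only [hΦ, hterm]
  rw [(hasSum_tupleProd_smul l (G := fun m : ℕ => 1 / (m : ℝ) ^ (a : ℕ)) (by simp) ?_).tsum_eq]
  · simp [polylogCoeff, div_eq_mul_inv]
  · refine hs.congr fun m => ?_
    rw [Real.norm_of_nonneg (by positivity), polylogCoeff, mul_one_div]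

lemma multiZetaTerm_eq (l : MZIndex) (s : ℂ) (f : Fin (l.length + 1) ↪o ℕ+) :
    multiZetaTerm l s f = tupleProd l.get (tupleInit f) •
      (fun m : ℕ => 1 / (m : ℂ) ^ s) (f (Fin.last l.length)) := by
  simp only [multiZetaTerm, tupleProd, tupleInit_apply, Complex.real_smul]
  push_cast
  simp only [Finset.prod_div_distrib, Finset.prod_const_one]
  rw [div_mul_div_comm, one_mul]

/-- The hypothesis s ≠ 0 makes the spurious term m = 0 vanish, as 0^0 = 1. -/
lemma hasSum_multiZetaTerm (l : MZIndex) {s : ℂ} (hs0 : s ≠ 0)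
    (hs : LSeriesSummable (fun n => (nestedSum l.reverse n : ℂ)) s) :
    HasSum (multiZetaTerm l s) (LSeries (fun n => (nestedSum l.reverse n : ℂ)) s) := by
  have h0 : 1 / ((0 : ℕ) : ℂ) ^ s = 0 := by simp [Complex.zero_cpow hs0]
  have hterm : ∀ m : ℕ, nestedSum l.reverse m • (1 / (m : ℂ) ^ s) =
      LSeries.term (fun n => (nestedSum l.reverse n : ℂ)) s m := fun m => by
    rw [LSeries.term_of_ne_zero' hs0, Complex.real_smul, mul_one_div]
  have h := hasSum_tupleProd_smul l (G := fun m : ℕ => 1 / (m : ℂ) ^ s) h0 ?_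
  · simp only [hterm] at h
    convert! h using 1
    exact funext fun f => multiZetaTerm_eq l s f
  · refine (hs.norm).congr fun m => ?_
    rw [← hterm, norm_smul, Real.norm_of_nonneg (nestedSum_nonneg _ _)]

/-! ### Logarithmic growth and values at 1 -/

lemma nestedSum_le_pow_sum_inv (l : List ℕ+) (m : ℕ) :
    nestedSum l m ≤ (∑ n ∈ Finset.range m, 1 / (n : ℝ)) ^ l.length := by
  induction l generalizing m with
  | nil => simp [nestedSum]
  | cons k l ih =>
    have hh : ∀ n ≤ m, (∑ i ∈ Finset.range n, 1 / (i : ℝ)) ≤ ∑ i ∈ Finset.range m, 1 / (i : ℝ) :=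
      fun n hn => Finset.sum_le_sum_of_subset_of_nonneg
        (Finset.range_subset_range.2 hn) fun i _ _ => by positivity
    rw [nestedSum_cons, List.length_cons, pow_succ, Finset.mul_sum]
    refine Finset.sum_le_sum fun n hn => (polylogCoeff_le_div k l n).trans ?_
    rw [mul_one_div]
    refine div_le_div_of_nonneg_right ((ih n).trans ?_) (Nat.cast_nonneg n)
    exact pow_le_pow_left₀ (Finset.sum_nonneg fun i _ => by positivity)
      (hh n (Finset.mem_range.1 hn).le) _

lemma sum_inv_le_one_add_log {m : ℕ} (hm : 1 ≤ m) :
    ∑ n ∈ Finset.range m, 1 / (n : ℝ) ≤ 1 + Real.log m := by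
  obtain ⟨m, rfl⟩ := Nat.exists_eq_add_of_le' hm
  rw [Finset.sum_range_succ']
  have h := harmonic_le_one_add_log m
  have h2 : ((harmonic m : ℚ) : ℝ) = ∑ n ∈ Finset.range m, 1 / ((n + 1 : ℕ) : ℝ) := by
    simp [harmonic]
  rw [← h2]
  rcases Nat.eq_zero_or_pos m with rfl | hm'
  · simp
  · have : Real.log m ≤ Real.log ((m + 1 : ℕ) : ℝ) :=
      Real.log_le_log (by positivity) (by push_cast; linarith)
    simp only [Nat.cast_zero, div_zero, add_zero]
    linarith

/-- A nested sum of depth r is at most the r-th power of a harmonic sum, hence of (1 + log n)^r.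
This gives convergence for Re s > 1 in every depth. -/
lemma nestedSum_isBigO (l : List ℕ+) {ε : ℝ} (hε : 0 < ε) :
    (fun n : ℕ => nestedSum l n) =O[atTop] fun n : ℕ => (n : ℝ) ^ ε := by
  have h1 : (fun x : ℝ => (1 + Real.log x) ^ (l.length : ℝ)) =O[atTop] fun x : ℝ => x ^ ε := by
    have h2 : (fun x : ℝ => (1 + Real.log x) ^ (l.length : ℝ)) =O[atTop]
        fun x : ℝ => (Real.log x) ^ (l.length : ℝ) := by
      refine Asymptotics.IsBigO.of_bound (2 ^ l.length) ?_
      filter_upwards [eventually_ge_atTop (Real.exp 1)] with x hx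
      have hlog : 1 ≤ Real.log x := by
        rwa [Real.le_log_iff_exp_le ((Real.exp_pos 1).trans_le hx)]
      rw [Real.rpow_natCast, Real.rpow_natCast, Real.norm_of_nonneg (by positivity),
        Real.norm_of_nonneg (by positivity), ← mul_pow]
      gcongr
      linarith
    exact h2.trans (isLittleO_log_rpow_rpow_atTop _ hε).isBigO
  refine Asymptotics.IsBigO.trans ?_ (h1.comp_tendsto tendsto_natCast_atTop_atTop)
  refine Asymptotics.IsBigO.of_bound 1 ?_
  filter_upwards [eventually_ge_atTop 1] with n hn
  rw [Real.norm_of_nonneg (nestedSum_nonneg l n), one_mul]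
  refine le_trans ?_ (Real.le_norm_self _)
  rw [Function.comp_apply, Real.rpow_natCast]
  exact (nestedSum_le_pow_sum_inv l n).trans (pow_le_pow_left₀
    (Finset.sum_nonneg fun i _ => by positivity) (sum_inv_le_one_add_log hn) _)

lemma LSeriesSummable_nestedSum (l : List ℕ+) {s : ℂ} (hs : 1 < s.re) :
    LSeriesSummable (fun n => (nestedSum l n : ℂ)) s := by
  obtain ⟨x, hx, hxs⟩ := exists_between hs
  refine LSeriesSummable_of_isBigO_rpow hxs ?_
  exact (Complex.isBigO_ofReal_left).2 (nestedSum_isBigO l (sub_pos.2 hx))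

lemma summable_polylogCoeff {k : ℕ+} (hk : 1 < k) (l : List ℕ+) :
    Summable (polylogCoeff k l) := by
  have h := LSeriesSummable_nestedSum l (s := ((k : ℕ) : ℂ)) (by
    rw [Complex.natCast_re]; exact_mod_cast hk)
  refine (h.norm).congr fun n => ?_
  rcases Nat.eq_zero_or_pos n with rfl | hn
  · simp [polylogCoeff_zero]
  · rw [LSeries.term_of_ne_zero hn.ne', Complex.cpow_natCast, norm_div, Complex.norm_real, norm_pow,
      Complex.norm_natCast, Real.norm_of_nonneg (nestedSum_nonneg l n), polylogCoeff]

lemma tsum_polylogCoeff_mem {k : ℕ+} (hk : 1 < k) (l : List ℕ+) :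
    ∑' n, polylogCoeff k l n ∈ multiZetaSpan (wordWeight (k :: l)) := by
  refine Submodule.subset_span ⟨l.reverse ++ [k], ?_, ?_, ?_⟩
  · intro a ha
    simp only [List.getLast?_append, List.getLast?_singleton, Option.mem_def] at ha
    simp at ha
    rwa [← ha]
  · simp [MZIndex.weight, wordWeight, add_comm, List.sum_reverse]
  · rw [multiZetaValue_append, List.reverse_reverse]
    rw [List.reverse_reverse]
    exact summable_polylogCoeff hk l

lemma one_mem_multiZetaSpan : (1 : ℝ) ∈ multiZetaSpan 0 := by
  refine Submodule.subset_span ⟨[], by simp [MZIndex.Admissible], rfl, ?_⟩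
  have : Unique (Fin (List.length ([] : MZIndex)) ↪o ℕ+) :=
    { default := ⟨⟨Fin.elim0, fun i => i.elim0⟩, fun {i} => i.elim0⟩
      uniq := fun f => by ext i; exact i.elim0 }
  rw [multiZetaValue, tsum_eq_single default fun f hf => absurd (Unique.eq_default f) hf]
  simp

/-- Abel's limit by dominated convergence; a head above 1 makes the coefficients themselves
summable. -/
lemma tendsto_wordPolylog_one {k : ℕ+} (hk : 1 < k) (l : List ℕ+) :
    Tendsto (fun z => wordPolylog (k :: l) (1 - z)) (𝓝[>] 0) (𝓝 (∑' n, polylogCoeff k l n)) := by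
  refine tendsto_tsum_of_dominated_convergence (summable_polylogCoeff hk l) (fun n => ?_) ?_
  · have : Tendsto (fun z : ℝ => polylogCoeff k l n * (1 - z) ^ n) (𝓝 0)
        (𝓝 (polylogCoeff k l n * (1 - 0) ^ n)) :=
      Continuous.tendsto (by fun_prop) 0
    simpa using this.mono_left nhdsWithin_le_nhds
  · filter_upwards [Ioo_mem_nhdsGT (zero_lt_one (α := ℝ))] with z hz n
    rw [Real.norm_of_nonneg (mul_nonneg (polylogCoeff_nonneg _ _ _)
      (pow_nonneg (by linarith [hz.2]) _))]
    exact mul_le_of_le_one_right (polylogCoeff_nonneg _ _ _)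
      (pow_le_one₀ (by linarith [hz.2]) (by linarith [hz.1]))

/-! ### Products of logarithms and polylogarithms, and their primitives -/

/-- The function `(-log z) ^ j / j!`. -/
noncomputable def logPow (j : ℕ) (z : ℝ) : ℝ := (-Real.log z) ^ j / (j.factorial : ℝ)

lemma hasDerivAt_logPow_zero (z : ℝ) : HasDerivAt (logPow 0) 0 z := by
  have : logPow 0 = fun _ => 1 := funext fun z => by simp [logPow]
  rw [this]
  exact hasDerivAt_const z 1

lemma hasDerivAt_logPow_succ (j : ℕ) {z : ℝ} (hz : z ≠ 0) :
    HasDerivAt (logPow (j + 1)) (-(logPow j z / z)) z := by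
  have h := (((Real.hasDerivAt_log hz).neg).pow (j + 1)).div_const ((j + 1).factorial : ℝ)
  convert! h using 1
  have : ((j : ℝ) + 1) ≠ 0 := by positivity
  simp only [logPow, Nat.factorial_succ, Nat.add_sub_cancel]
  push_cast
  simp only [Pi.neg_apply]
  field_simp

lemma logPow_one_mul (j : ℕ) (z : ℝ) : logPow 1 z * logPow j z = (j + 1) * logPow (j + 1) z := by
  have : ((j : ℝ) + 1) ≠ 0 := by positivity
  simp only [logPow, Nat.factorial_succ, Nat.factorial_zero]
  push_cast
  field_simp
  ring

lemma tendsto_logPow_mul_wordPolylog (j : ℕ) (k : ℕ+) (l : List ℕ+) :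
    Tendsto (fun z => logPow j z * wordPolylog (k :: l) z) (𝓝[>] 0) (𝓝 0) := by
  have h1 : Tendsto (fun z : ℝ => |Real.log z| ^ (j : ℝ) * z) (𝓝[>] 0) (𝓝 0) := by
    have h := (isLittleO_abs_log_rpow_rpow_nhdsGT_zero (j : ℝ)
      (by norm_num : (-1 : ℝ) < 0)).tendsto_div_nhds_zero
    refine h.congr' ?_
    filter_upwards [self_mem_nhdsWithin] with z hz
    rw [Real.rpow_neg_one, div_inv_eq_mul]
  have h2 := h1.mul_const (2 : ℝ)
  rw [zero_mul] at h2
  refine squeeze_zero_norm' ?_ h2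
  filter_upwards [Ioo_mem_nhdsGT (show (0 : ℝ) < 1 / 2 by norm_num)] with z hz
  have hz0 : 0 < 1 - z := by linarith [hz.2]
  rw [norm_mul, Real.norm_of_nonneg (wordPolylog_nonneg _ hz.1.le), Real.rpow_natCast, mul_assoc]
  refine mul_le_mul ?_ ?_ (wordPolylog_nonneg _ hz.1.le) (by positivity)
  · rw [logPow, norm_div, norm_pow, norm_neg, Real.norm_eq_abs, Real.norm_natCast]
    exact div_le_self (by positivity) (by exact_mod_cast Nat.one_le_iff_ne_zero.2 j.factorial_ne_zero)
  · refine (wordPolylog_cons_le k l hz.1.le (by linarith [hz.2])).trans ?_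
    rw [div_le_iff₀ hz0]
    nlinarith [hz.1, hz.2]

/-- The span of the functions `a * (-log z) ^ j / j! * Li_l(z)` of total weight `n`, where `a` is a
rational combination of multiple zeta values. -/
noncomputable def logPolylogSpan (n : ℕ) : Submodule ℚ (ℝ → ℝ) :=
  Submodule.span ℚ {f | ∃ u j l, u + j + wordWeight l = n ∧ ∃ a ∈ multiZetaSpan u,
    f = fun z => a * (logPow j z * wordPolylog l z)}

lemma mem_logPolylogSpan {u j : ℕ} {l : List ℕ+} {n : ℕ} (h : u + j + wordWeight l = n) {a : ℝ}
    (ha : a ∈ multiZetaSpan u) :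
    (fun z => a * (logPow j z * wordPolylog l z)) ∈ logPolylogSpan n :=
  Submodule.subset_span ⟨u, j, l, h, a, ha, rfl⟩

lemma logPow_one_mul_mem {n : ℕ} {f : ℝ → ℝ} (hf : f ∈ logPolylogSpan n) :
    (fun z => logPow 1 z * f z) ∈ logPolylogSpan (n + 1) := by
  induction hf using Submodule.span_induction with
  | mem f hf =>
    obtain ⟨u, j, l, h, a, ha, rfl⟩ := hf
    have ha' : (((j + 1 : ℕ) : ℚ) • a) ∈ multiZetaSpan u := Submodule.smul_mem _ _ ha
    convert! mem_logPolylogSpan (j := j + 1) (l := l) (n := n + 1) (by omega) ha' using 1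
    funext z
    have := logPow_one_mul j z
    rw [Rat.smul_def]
    push_cast
    linear_combination a * wordPolylog l z * this
  | zero => simp only [Pi.zero_apply, mul_zero]; exact Submodule.zero_mem _
  | add f g _ _ hf hg => simpa [mul_add] using! Submodule.add_mem _ hf hg
  | smul c f _ hf =>
    convert! Submodule.smul_mem _ c hf using 1
    funext z
    simp only [Pi.smul_apply, Rat.smul_def]
    ring

lemma hasDerivAt_logPow_sub (j i : ℕ) {z : ℝ} (hz : z ≠ 0) :
    HasDerivAt (logPow (j - i)) (if i < j then -(logPow (j - (i + 1)) z / z) else 0) z := by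
  split_ifs with h
  · rw [show j - i = j - (i + 1) + 1 by omega]
    exact hasDerivAt_logPow_succ _ hz
  · rw [show j - i = 0 by omega]
    exact hasDerivAt_logPow_zero z

/-- Iterated integration by parts. -/
lemma hasDerivAt_sum_logPow_mul (j : ℕ) (l : List ℕ+) {z : ℝ} (hz : z ∈ Ioo (0 : ℝ) 1) :
    HasDerivAt (fun z => ∑ i ∈ Finset.range (j + 1),
      logPow (j - i) z * wordPolylog (i.succPNat :: l) z)
      (logPow j z * wordPolylog l z / (1 - z)) z := by
  have hz' : |z| < 1 := by rw [abs_of_pos hz.1]; exact hz.2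
  -- The two halves of each product-rule derivative are consecutive terms of X, so the sum
  -- telescopes to X 0. The cutoff i < j records that the last logarithmic power is constant.
  obtain ⟨X, hX0, hXs⟩ : ∃ X : ℕ → ℝ, X 0 = logPow j z * wordPolylog l z / (1 - z) ∧
      ∀ i, X (i + 1) = if i < j then
        logPow (j - (i + 1)) z * wordPolylog (i.succPNat :: l) z / z else 0 :=
    ⟨fun i => Nat.casesOn i (logPow j z * wordPolylog l z / (1 - z)) fun i => if i < j then
        logPow (j - (i + 1)) z * wordPolylog (i.succPNat :: l) z / z else 0, rfl, fun _ => rfl⟩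
  have hd : ∀ i ∈ Finset.range (j + 1), HasDerivAt (fun z =>
      logPow (j - i) z * wordPolylog (i.succPNat :: l) z) (X i - X (i + 1)) z := by
    intro i hi
    have hL := hasDerivAt_logPow_sub j i hz.1.ne'
    rcases i with _ | i
    · convert! hL.mul (hasDerivAt_wordPolylog_one l hz') using 1
      rw [hX0, hXs, show Nat.succPNat 0 = 1 from rfl, Nat.sub_zero]
      split_ifs <;> ring
    · convert! hL.mul (hasDerivAt_wordPolylog_succ i.succPNat l hz' hz.1.ne') using 1
      have hi' : i < j := by simpa using hi
      rw [hXs, hXs, if_pos hi']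
      change _ = _ * wordPolylog ((i + 1).succPNat :: l) z + _
      split_ifs <;> ring
  convert! HasDerivAt.fun_sum hd using 1
  rw [Finset.sum_range_sub']
  rw [hX0, hXs, if_neg (lt_irrefl j), sub_zero]

/-- Repeated integration by parts trades powers of the logarithm for a larger head letter, so
coefficients are unchanged and the weight grows by one. Every resulting word is nonempty, so its
polylogarithm vanishes at 0 fast enough to beat the logarithms. -/
lemma exists_primitive {n : ℕ} {f : ℝ → ℝ} (hf : f ∈ logPolylogSpan n) :
    ∃ g ∈ logPolylogSpan (n + 1), (∀ z ∈ Ioo (0 : ℝ) 1, HasDerivAt g (f z / (1 - z)) z) ∧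
      Tendsto g (𝓝[>] 0) (𝓝 0) := by
  induction hf using Submodule.span_induction with
  | mem f hf =>
    obtain ⟨u, j, l, h, a, ha, rfl⟩ := hf
    refine ⟨fun z => a * ∑ i ∈ Finset.range (j + 1),
      logPow (j - i) z * wordPolylog (i.succPNat :: l) z, ?_, fun z hz => ?_, ?_⟩
    · have : (fun z => a * ∑ i ∈ Finset.range (j + 1),
          logPow (j - i) z * wordPolylog (i.succPNat :: l) z) =
          ∑ i ∈ Finset.range (j + 1), fun z =>
            a * (logPow (j - i) z * wordPolylog (i.succPNat :: l) z) := by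
        funext z
        simp [Finset.mul_sum]
      rw [this]
      refine Submodule.sum_mem _ fun i hi => mem_logPolylogSpan (u := u) ?_ ha
      have := Finset.mem_range.1 hi
      rw [wordWeight_cons, Nat.succPNat_coe]
      omega
    · convert! (hasDerivAt_sum_logPow_mul j l hz).const_mul a using 1
      ring
    · have h := (tendsto_finsetSum (Finset.range (j + 1)) fun i _ =>
        tendsto_logPow_mul_wordPolylog (j - i) i.succPNat l).const_mul a
      simpa using h
  | zero => exact ⟨0, Submodule.zero_mem _, fun z _ => by
      convert! hasDerivAt_const z (0 : ℝ) using 1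
      simp,
      tendsto_const_nhds⟩
  | add f₁ f₂ _ _ h₁ h₂ =>
    obtain ⟨g₁, hg₁, hd₁, ht₁⟩ := h₁
    obtain ⟨g₂, hg₂, hd₂, ht₂⟩ := h₂
    refine ⟨g₁ + g₂, Submodule.add_mem _ hg₁ hg₂, fun z hz => ?_, by simpa using! ht₁.add ht₂⟩
    convert! (hd₁ z hz).add (hd₂ z hz) using 1
    simp [add_div]
  | smul c f _ h =>
    obtain ⟨g, hg, hd, ht⟩ := h
    have hc : c • g = fun x => (c : ℝ) * g x := funext fun x => by simp [Rat.smul_def]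
    refine ⟨c • g, Submodule.smul_mem _ _ hg, fun z hz => ?_, ?_⟩
    · rw [hc]
      convert! (hd z hz).const_mul (c : ℝ) using 1
      simp [Rat.smul_def, mul_div_assoc]
    · rw [hc]
      simpa using ht.const_mul (c : ℝ)

/-! ### The reflection z to 1 - z -/

/-- The function `z ↦ Li_w(1 - z)` on `(0, 1)` is in the span of the products of powers of the
logarithm and multiple polylogarithms, of the same weight. -/
def HasReflection (w : List ℕ+) : Prop :=
  ∃ f ∈ logPolylogSpan (wordWeight w), ∀ z ∈ Ioo (0 : ℝ) 1, wordPolylog w (1 - z) = f z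

lemma hasReflection_nil : HasReflection [] := by
  refine ⟨_, mem_logPolylogSpan (u := 0) (j := 0) (l := []) (n := 0) rfl one_mem_multiZetaSpan,
    fun z _ => ?_⟩
  simp [logPow, wordPolylog]

/-- The derivative of Li(1 - z) is minus f / (1 - z), so adding the primitive g of f / (1 - z) gives
a constant. As g tends to 0, the constant is the value of the polylogarithm at 1, a multiple zeta
value of the full weight. -/
lemma HasReflection.succ {k : ℕ+} {l : List ℕ+} (h : HasReflection (k :: l)) :
    HasReflection ((k + 1) :: l) := by
  obtain ⟨f, hf, hfz⟩ := h
  obtain ⟨g, hg, hd, ht⟩ := exists_primitive hf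
  have hk : 1 < k + 1 := PNat.lt_add_left 1 k
  set ζ := ∑' n, polylogCoeff (k + 1) l n
  have hw : wordWeight ((k + 1) :: l) = wordWeight (k :: l) + 1 := by
    simp; omega
  have hder : ∀ z ∈ Ioo (0 : ℝ) 1,
      HasDerivAt (fun z => wordPolylog ((k + 1) :: l) (1 - z) + g z) 0 z := by
    intro z hz
    have h1 : |1 - z| < 1 := by rw [abs_lt]; constructor <;> linarith [hz.1, hz.2]
    have h2 : 1 - z ≠ 0 := by linarith [hz.2]
    have h3 := (hasDerivAt_wordPolylog_succ k l h1 h2).comp z ((hasDerivAt_id z).const_sub 1)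
    convert! h3.add (hd z hz) using 1
    rw [hfz z hz]
    ring
  have hlim : Tendsto (fun z => wordPolylog ((k + 1) :: l) (1 - z) + g z) (𝓝[>] 0) (𝓝 ζ) := by
    simpa using (tendsto_wordPolylog_one hk l).add ht
  have hconst : ∀ z ∈ Ioo (0 : ℝ) 1, wordPolylog ((k + 1) :: l) (1 - z) + g z = ζ := by
    intro z hz
    refine tendsto_nhds_unique (tendsto_const_nhds.congr' ?_) hlim
    filter_upwards [Ioo_mem_nhdsGT (zero_lt_one (α := ℝ))] with y hy
    exact isOpen_Ioo.is_const_of_deriv_eq_zero isPreconnected_Ioo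
      (fun x hx => (hder x hx).differentiableAt.differentiableWithinAt)
      (fun x hx => (hder x hx).deriv) hz hy
  have hζ : (fun z => ζ * (logPow 0 z * wordPolylog [] z)) ∈
      logPolylogSpan (wordWeight ((k + 1) :: l)) :=
    mem_logPolylogSpan (by simp) (tsum_polylogCoeff_mem hk l)
  refine ⟨(fun z => ζ * (logPow 0 z * wordPolylog [] z)) - g,
    Submodule.sub_mem _ hζ (hw ▸ hg), fun z hz => ?_⟩
  have := hconst z hz
  simp only [Pi.sub_apply, logPow, show wordPolylog [] z = 1 from rfl, pow_zero,
    Nat.factorial_zero, Nat.cast_one]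
  linarith

lemma polylogSum_reflection {n : ℕ} {I : List (List ℕ+)}
    (h : ∀ v ∈ I, wordWeight v = n ∧ HasReflection v) :
    ∃ f ∈ logPolylogSpan n, ∀ z ∈ Ioo (0 : ℝ) 1, polylogSum I (1 - z) = f z := by
  induction I with
  | nil => exact ⟨0, Submodule.zero_mem _, fun z _ => by simp [polylogSum]⟩
  | cons v I ih =>
    obtain ⟨f, hf, hfz⟩ := ih fun u hu => h u (by simp [hu])
    obtain ⟨hv, g, hg, hgz⟩ := h v (by simp)
    refine ⟨g + f, Submodule.add_mem _ (hv ▸ hg) hf, fun z hz => ?_⟩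
    rw [Pi.add_apply, ← hgz z hz, ← hfz z hz]
    simp [polylogSum]

/-- Since Li_1(1 - z) = -log z, the product on the left stays in the span; the relation is then
solved for the term with coefficient a + 1, which is invertible over the rationals. -/
lemma HasReflection.of_shuffle {a : ℕ} {w : List ℕ+} {I : List (List ℕ+)} (hw : HasReflection w)
    (hI : ∀ v ∈ I, wordWeight v = wordWeight w + 1 ∧ HasReflection v)
    (h : ∀ x ∈ Ico (0 : ℝ) 1, wordPolylog [1] x * wordPolylog w x =
      (a + 1) * wordPolylog (1 :: w) x + polylogSum I x) : HasReflection (1 :: w) := by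
  obtain ⟨f, hf, hfz⟩ := hw
  obtain ⟨g, hg, hgz⟩ := polylogSum_reflection hI
  have hwt : wordWeight (1 :: w) = wordWeight w + 1 := by simp [add_comm]
  refine ⟨((a : ℚ) + 1)⁻¹ • ((fun z => logPow 1 z * f z) - g), ?_, fun z hz => ?_⟩
  · rw [hwt]
    exact Submodule.smul_mem _ _ (Submodule.sub_mem _ (logPow_one_mul_mem hf) hg)
  · have h1 := h (1 - z) ⟨by linarith [hz.2], by linarith [hz.1]⟩
    have h2 : wordPolylog [1] (1 - z) = logPow 1 z := by
      rw [wordPolylog_singleton_one (by rw [abs_lt]; constructor <;> linarith [hz.1, hz.2])]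
      simp [logPow]
    rw [h2, hfz z hz, hgz z hz] at h1
    have h3 : (a : ℝ) + 1 ≠ 0 := by positivity
    simp only [Pi.smul_apply, Pi.sub_apply, Rat.smul_def]
    push_cast
    rw [h1]
    field_simp
    ring

/-- The words `1, …, 1, w₀` with `a` ones, where `w₀` does not start with `1`. -/
def IsOnesAppend (a : ℕ) (w : List ℕ+) : Prop :=
  ∃ w₀ : List ℕ+, (∀ k ∈ w₀.head?, 1 < k) ∧ w = List.replicate a 1 ++ w₀

lemma exists_isOnesAppend (w : List ℕ+) : ∃ a, IsOnesAppend a w := by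
  induction w with
  | nil => exact ⟨0, [], by simp, rfl⟩
  | cons k l ih =>
    by_cases hk : k = 1
    · obtain ⟨a, w₀, h, rfl⟩ := ih
      exact ⟨a + 1, w₀, h, by rw [hk]; rfl⟩
    · exact ⟨0, k :: l, by
        simpa using lt_of_le_of_ne (one_le (a := k)) (Ne.symm hk), rfl⟩

/-- Shuffling one more 1 into a leading ones produces a + 1 copies of the word with a + 1 ones; in
all other words the new letter lands later, so no more than a ones lead. For a = 0 and nonempty `w₀`
the other words have a raised head and start with no 1. -/
lemma exists_shuffle_ones {w₀ : List ℕ+} (hw₀ : ∀ k ∈ w₀.head?, 1 < k) (a : ℕ) :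
    ∃ I : List (List ℕ+),
      (∀ v ∈ I, wordWeight v = wordWeight (List.replicate a 1 ++ w₀) + 1 ∧
        ∃ b ≤ a, IsOnesAppend b v) ∧
      ∀ x ∈ Ico (0 : ℝ) 1, wordPolylog [1] x * wordPolylog (List.replicate a 1 ++ w₀) x =
        (a + 1) * wordPolylog (1 :: (List.replicate a 1 ++ w₀)) x + polylogSum I x := by
  induction a with
  | zero =>
    rcases w₀ with _ | ⟨k, l⟩
    · exact ⟨[], by simp, fun x _ => by simp [polylogSum, wordPolylog]⟩
    · obtain ⟨k, rfl⟩ := PNat.exists_eq_succ_of_ne_one (n := k)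
        (hw₀ k (by simp)).ne'
      obtain ⟨I, hI, hI'⟩ := exists_shuffle_one (k :: l)
      refine ⟨I.map bumpHead, ?_, fun x hx => ?_⟩
      · simp only [List.mem_map]
        rintro v ⟨u, hu, rfl⟩
        obtain ⟨c, u, rfl⟩ := List.exists_cons_of_ne_nil (hI u hu).1
        refine ⟨?_, 0, le_rfl, _, ?_, rfl⟩
        · have := (hI _ hu).2
          simp [bumpHead] at this ⊢; omega
        · simp
      · simpa using wordPolylog_one_mul_succ (fun v hv => (hI v hv).1) hI' x hx
  | succ a ih =>
    obtain ⟨I, hI, hI'⟩ := ih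
    refine ⟨I.map (List.cons 1), ?_, fun x hx => ?_⟩
    · simp only [List.mem_map]
      rintro v ⟨u, hu, rfl⟩
      obtain ⟨hu, b, hb, w₁, hw₁, rfl⟩ := hI u hu
      refine ⟨?_, b + 1, by omega, w₁, hw₁, rfl⟩
      rw [List.replicate_succ, List.cons_append, wordWeight_cons, wordWeight_cons, hu]
      omega
    · rw [List.replicate_succ, List.cons_append]
      push_cast
      exact wordPolylog_one_mul_cons_one hI' x hx

/-- Induction on the weight and, within a weight, on the number of leading ones: the shuffle
relation keeps the weight but yields words with fewer leading ones. -/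
theorem hasReflection (w : List ℕ+) : HasReflection w := by
  suffices h : ∀ n a : ℕ, ∀ w, wordWeight w = n → IsOnesAppend a w → HasReflection w by
    obtain ⟨a, ha⟩ := exists_isOnesAppend w
    exact h _ a w rfl ha
  intro n
  induction n with
  | zero =>
    rintro a w hw -
    rcases w with _ | ⟨k, l⟩
    · exact hasReflection_nil
    · have := k.pos
      rw [wordWeight_cons] at hw
      omega
  | succ n ihn =>
    intro a
    induction a using Nat.strong_induction_on with
    | _ a iha =>
      rintro w hw ⟨w₀, hw₀, rfl⟩
      rcases a with _ | a
      · rcases w₀ with _ | ⟨k, l⟩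
        · exact hasReflection_nil
        · obtain ⟨k, rfl⟩ := PNat.exists_eq_succ_of_ne_one (n := k) (hw₀ k (by simp)).ne'
          obtain ⟨a, ha⟩ := exists_isOnesAppend (k :: l)
          refine (ihn a (k :: l) ?_ ha).succ
          simp at hw ⊢
          omega
      · rw [List.replicate_succ, List.cons_append] at hw ⊢
        rw [wordWeight_cons, PNat.one_coe] at hw
        obtain ⟨I, hI, hI'⟩ := exists_shuffle_ones hw₀ a
        refine HasReflection.of_shuffle (ihn a _ (by omega) ⟨w₀, hw₀, rfl⟩) (fun v hv => ?_) hI'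
        obtain ⟨hv, b, hb, hbv⟩ := hI v hv
        exact ⟨hv, iha b (by omega) v (by omega) hbv⟩

/-! ### Identity theorem and gluing over half-planes -/

lemma isOpen_halfPlane (c : ℝ) : IsOpen {s : ℂ | c < s.re} :=
  isOpen_lt continuous_const Complex.continuous_re

lemma isPreconnected_halfPlane (c : ℝ) : IsPreconnected {s : ℂ | c < s.re} :=
  (convex_halfSpace_re_gt c).isPreconnected

lemma halfPlane_mem_nhds {c : ℝ} {s : ℂ} (hs : c < s.re) : {s : ℂ | c < s.re} ∈ 𝓝 s :=
  (isOpen_halfPlane c).mem_nhds hs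

/-- Identity theorem for meromorphic functions. -/
lemma MeromorphicOn.eventuallyEq_nhdsNE_of_isPreconnected {F G : ℂ → ℂ} {U : Set ℂ}
    (hF : MeromorphicOn F U) (hG : MeromorphicOn G U) (hU : IsPreconnected U) {z x : ℂ}
    (hz : z ∈ U) (h : F =ᶠ[𝓝[≠] z] G) (hx : x ∈ U) : F =ᶠ[𝓝[≠] x] G := by
  have hD : MeromorphicOn (F - G) U := hF.sub hG
  have hz' : meromorphicOrderAt (F - G) z = ⊤ := by
    rw [meromorphicOrderAt_eq_top_iff]
    filter_upwards [h] with y hy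
    simp [hy]
  by_cases hx' : meromorphicOrderAt (F - G) x = ⊤
  · rw [meromorphicOrderAt_eq_top_iff] at hx'
    filter_upwards [hx'] with y hy
    simpa [sub_eq_zero] using hy
  · exact absurd hz' (hD.meromorphicOrderAt_ne_top_of_isPreconnected hU hx hz hx')

/-- Normal form fixes the values at poles and removable singularities, so agreement off isolated
points becomes agreement everywhere. -/
lemma MeromorphicNFOn.eqOn_of_isPreconnected {F G : ℂ → ℂ} {U : Set ℂ}
    (hF : MeromorphicNFOn F U) (hG : MeromorphicNFOn G U) (hU : IsPreconnected U) {z : ℂ}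
    (hz : z ∈ U) (h : F =ᶠ[𝓝 z] G) : EqOn F G U := fun _ hx =>
  (((hF hx).eventuallyEq_nhdsNE_iff_eventuallyEq_nhds (hG hx)).1
    (hF.meromorphicOn.eventuallyEq_nhdsNE_of_isPreconnected hG.meromorphicOn hU hz
      (h.filter_mono nhdsWithin_le_nhds) hx)).eq_of_nhds

/-- Functions on an increasing sequence of half-planes exhausting the plane that agree far to the
right are the restrictions of one function. -/
lemma exists_glue_halfPlane {F : ℕ → ℂ → ℂ} {f : ℂ → ℂ} {c d : ℝ}
    (hF : ∀ N : ℕ, MeromorphicNFOn (F N) {s | c - N < s.re})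
    (hf : ∀ N : ℕ, EqOn (F N) f {s | d < s.re}) :
    ∃ G : ℂ → ℂ, MeromorphicNFOn G univ ∧ ∀ N : ℕ, EqOn G (F N) {s | c - N < s.re} := by
  have key : ∀ N M : ℕ, N ≤ M → EqOn (F N) (F M) {s | c - N < s.re} := by
    intro N M hNM
    have hsub : {s : ℂ | c - N < s.re} ⊆ {s | c - M < s.re} := fun s hs => by
      have : (N : ℝ) ≤ M := by exact_mod_cast hNM
      have hs' : c - N < s.re := hs
      show c - M < s.re
      linarith
    -- The base point lies in all the half-planes and in the region where every member equals f.
    refine MeromorphicNFOn.eqOn_of_isPreconnected (z := ((max c d + 1 : ℝ) : ℂ)) (hF N)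
      (fun s hs => hF M (hsub hs)) (isPreconnected_halfPlane _) ?_ ?_
    · have := le_max_left c d
      have hN : (0 : ℝ) ≤ N := Nat.cast_nonneg N
      simp only [mem_ofPred_eq, Complex.ofReal_re]
      linarith
    · have hmem : {s : ℂ | d < s.re} ∈ 𝓝 ((max c d + 1 : ℝ) : ℂ) := halfPlane_mem_nhds (by
        have := le_max_right c d
        rw [Complex.ofReal_re]; linarith)
      filter_upwards [hmem] with s hs
      rw [hf N hs, hf M hs]
  have key2 : ∀ N M : ℕ, ∀ s : ℂ, c - N < s.re → c - M < s.re → F N s = F M s := by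
    intro N M s hN hM
    rcases le_total N M with h | h
    · exact key N M h hN
    · exact (key M N h hM).symm
  have hex : ∀ s : ℂ, ∃ N : ℕ, c - N < s.re := fun s => by
    obtain ⟨N, hN⟩ := exists_nat_gt (c - s.re)
    exact ⟨N, by linarith⟩
  choose n hn using hex
  have hG : ∀ N : ℕ, EqOn (fun s => F (n s) s) (F N) {s | c - N < s.re} := fun N s hs =>
    key2 _ _ s (hn s) hs
  refine ⟨fun s => F (n s) s, fun s _ => ?_, hG⟩
  refine (meromorphicNFAt_congr ?_).2 (hF (n s) (hn s))
  filter_upwards [halfPlane_mem_nhds (hn s)] with t ht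
  exact hG _ ht

lemma AnalyticAt.toMeromorphicNFOn_eq {f : ℂ → ℂ} {U : Set ℂ} {s : ℂ} (hf : AnalyticAt ℂ f s)
    (hU : MeromorphicOn f U) (hs : s ∈ U) : toMeromorphicNFOn f U s = f s := by
  rw [toMeromorphicNFOn_eq_toMeromorphicNFAt hU hs,
    toMeromorphicNFAt_eq_self.2 hf.meromorphicNFAt]

lemma meromorphicContinuation_spec {f : ℂ → ℂ} {U : Set ℂ} (h : ∃ F, IsMeromorphicContinuation f U F) :
    IsMeromorphicContinuation f U (meromorphicContinuation f U) :=
  Classical.epsilon_spec h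

/-- An entire extension of `f` is the meromorphic continuation of `f`. -/
lemma meromorphicContinuation_eq {f F : ℂ → ℂ} {c : ℝ} (hF : Differentiable ℂ F)
    (h : EqOn F f {s | c < s.re}) : meromorphicContinuation f {s | c < s.re} = F := by
  have hFN : MeromorphicNFOn F univ := fun s _ => (hF.analyticAt s).meromorphicNFAt
  have hspec := meromorphicContinuation_spec ⟨F, hFN, h⟩
  funext s
  refine hspec.1.eqOn_of_isPreconnected hFN isPreconnected_univ (mem_univ ((c + 1 : ℝ) : ℂ)) ?_
    (mem_univ s)
  have hmem : {s : ℂ | c < s.re} ∈ 𝓝 ((c + 1 : ℝ) : ℂ) := halfPlane_mem_nhds (by simp)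
  filter_upwards [hmem] with t ht
  rw [hspec.2 ht, h ht]

/-! ### Binomial remainders and the translation formula -/

/-- The Taylor coefficients `a (a + 1) ⋯ (a + q - 1) / q!` of `(1 - x) ^ (-a)`. -/
noncomputable def pochCoeff (q : ℕ) (a : ℂ) : ℂ := (ascPochhammer ℂ q).eval a / (q.factorial : ℂ)

/-- The remainder of order `Q` in the Taylor expansion of `(1 - x) ^ (-a)`. -/
noncomputable def binomRem (Q : ℕ) (a : ℂ) (x : ℝ) : ℂ :=
  ((1 - x : ℝ) : ℂ) ^ (-a) - ∑ q ∈ Finset.range Q, pochCoeff q a * (x : ℂ) ^ q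

lemma pochCoeff_zero (a : ℂ) : pochCoeff 0 a = 1 := by simp [pochCoeff]

lemma pochCoeff_one (a : ℂ) : pochCoeff 1 a = a := by simp [pochCoeff]

lemma succ_mul_pochCoeff (q : ℕ) (a : ℂ) :
    (q + 1 : ℂ) * pochCoeff (q + 1) a = a * pochCoeff q (a + 1) := by
  have h1 : ((q : ℂ) + 1) ≠ 0 := Nat.cast_add_one_ne_zero q
  have h2 : (q.factorial : ℂ) ≠ 0 := by exact_mod_cast q.factorial_ne_zero
  rw [pochCoeff, pochCoeff, ascPochhammer_succ_left, Nat.factorial_succ]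
  simp only [Polynomial.eval_mul, Polynomial.eval_X, Polynomial.eval_comp, Polynomial.eval_add,
    Polynomial.eval_one]
  push_cast
  field_simp

lemma differentiable_pochCoeff (q : ℕ) : Differentiable ℂ (pochCoeff q) :=
  (Polynomial.differentiable _).div_const _

lemma hasDerivAt_binomRem (Q : ℕ) (a : ℂ) {x : ℝ} (hx : x < 1) :
    HasDerivAt (binomRem (Q + 1) a) (a * binomRem Q (a + 1) x) x := by
  have hx' : (0 : ℝ) < 1 - x := sub_pos.2 hx
  have h1 : HasDerivAt (fun x : ℝ => ((1 - x : ℝ) : ℂ) ^ (-a))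
      (a * ((1 - x : ℝ) : ℂ) ^ (-(a + 1))) x := by
    have hs : ((1 - x : ℝ) : ℂ) ∈ Complex.slitPlane := Complex.ofReal_mem_slitPlane.2 hx'
    have hb : HasDerivAt (fun x : ℝ => ((1 - x : ℝ) : ℂ)) (((-1 : ℝ) : ℝ) : ℂ) x :=
      ((hasDerivAt_id x).const_sub 1).ofReal_comp
    have hc := (HasDerivAt.cpow_const (c := -a) (hasDerivAt_id ((1 - x : ℝ) : ℂ)) hs).comp x hb
    convert! hc using 1
    push_cast
    rw [show -(a + 1) = -a - 1 by ring]
    simp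
  have h2 : HasDerivAt (fun x : ℝ => ∑ q ∈ Finset.range (Q + 1), pochCoeff q a * (x : ℂ) ^ q)
      (∑ q ∈ Finset.range Q, a * (pochCoeff q (a + 1) * (x : ℂ) ^ q)) x := by
    have h3 : ∀ q ∈ Finset.range (Q + 1), HasDerivAt (fun x : ℝ => pochCoeff q a * (x : ℂ) ^ q)
        (pochCoeff q a * (q * (x : ℂ) ^ (q - 1))) x := fun q _ =>
      ((hasDerivAt_pow q (x : ℂ)).comp_ofReal).const_mul _
    convert! HasDerivAt.fun_sum h3 using 1
    rw [Finset.sum_range_succ']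
    simp only [Nat.cast_zero, zero_mul, mul_zero, add_zero, Nat.add_sub_cancel]
    refine Finset.sum_congr rfl fun q _ => ?_
    have := succ_mul_pochCoeff q a
    push_cast
    linear_combination -(x : ℂ) ^ q * this
  convert! h1.sub h2 using 1
  rw [binomRem, mul_sub, Finset.mul_sum]

lemma binomRem_zero_right (Q : ℕ) (a : ℂ) : binomRem (Q + 1) a 0 = 0 := by
  rw [binomRem, Finset.sum_range_succ']
  simp [pochCoeff_zero]

/-- The remainder of order Q + 1 vanishes at 0 and its derivative is a times the remainder of order
Q at a + 1, so the mean value inequality gains one power of x. The shift of a is why the induction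
uses M + 1. Uniformity in a is needed for holomorphy in s. -/
lemma exists_binomRem_bound (Q : ℕ) (M : ℝ) : ∃ C : ℝ, 0 ≤ C ∧ ∀ a : ℂ, ‖a‖ ≤ M →
    ∀ x ∈ Icc (0 : ℝ) (1 / 2), ‖binomRem Q a x‖ ≤ C * x ^ Q := by
  induction Q generalizing M with
  | zero =>
    refine ⟨(1 / 2 : ℝ) ^ (-M), by positivity, fun a ha x hx => ?_⟩
    have hM : 0 ≤ M := (norm_nonneg a).trans ha
    have hx' : (1 : ℝ) / 2 ≤ 1 - x := by linarith [hx.2]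
    have hx0 : (0 : ℝ) < 1 - x := by linarith
    rw [binomRem, Finset.sum_range_zero, sub_zero, pow_zero, mul_one,
      Complex.norm_cpow_eq_rpow_re_of_pos hx0]
    calc (1 - x) ^ (-a).re ≤ (1 - x) ^ (-M) := by
          refine Real.rpow_le_rpow_of_exponent_ge hx0 (by linarith [hx.1]) ?_
          rw [Complex.neg_re, neg_le_neg_iff]
          exact (Complex.re_le_norm a).trans ha
      _ ≤ _ := Real.rpow_le_rpow_of_nonpos (by norm_num) hx' (by linarith)
  | succ Q ih =>
    obtain ⟨C, hC0, hC⟩ := ih (M + 1)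
    refine ⟨|M| * C, by positivity, fun a ha x hx => ?_⟩
    have hbound : ∀ y ∈ Ico (0 : ℝ) x, ‖a * binomRem Q (a + 1) y‖ ≤ |M| * (C * x ^ Q) := by
      intro y hy
      rw [norm_mul]
      refine mul_le_mul (ha.trans (le_abs_self M)) ?_ (norm_nonneg _) (abs_nonneg M)
      refine (hC (a + 1) ?_ y ⟨hy.1, hy.2.le.trans hx.2⟩).trans ?_
      · exact (norm_add_le _ _).trans (by simpa using ha)
      · have := hy.1
        have := hy.2.le
        gcongr
    have h := norm_image_sub_le_of_norm_deriv_le_segment' (f := binomRem (Q + 1) a)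
      (fun y hy => (hasDerivAt_binomRem Q a
        (by linarith [hy.2, hx.2])).hasDerivWithinAt) hbound x ⟨hx.1, le_rfl⟩
    rw [binomRem_zero_right, sub_zero, sub_zero] at h
    exact h.trans_eq (by ring)

lemma differentiableAt_binomRem (Q : ℕ) {x : ℝ} (hx : x < 1) (a : ℂ) :
    DifferentiableAt ℂ (fun a => binomRem Q a x) a := by
  have hx0 : ((1 - x : ℝ) : ℂ) ≠ 0 := by
    rw [Complex.ofReal_ne_zero]; linarith
  refine DifferentiableAt.sub (differentiableAt_id.neg.const_cpow (Or.inl hx0)) ?_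
  exact DifferentiableAt.fun_sum fun q _ => (differentiable_pochCoeff q a).mul_const _

/-- The general term of the error series in the translation formula. -/
noncomputable def transTerm (k : ℕ+) (l : List ℕ+) (Q : ℕ) (s : ℂ) (m : ℕ) : ℂ :=
  nestedSum (k :: l) m * ((m : ℂ) ^ (1 - s) * binomRem Q (s - 1) (1 / m))

lemma nestedSum_cons_eq_zero (k : ℕ+) (l : List ℕ+) {m : ℕ} (hm : m < 2) :
    nestedSum (k :: l) m = 0 := by
  interval_cases m
  · exact nestedSum_cons_zero k l
  · rw [nestedSum_cons_succ, nestedSum_cons_zero, polylogCoeff_zero, add_zero]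

lemma one_div_natCast_mem {m : ℕ} (hm : 2 ≤ m) : (1 / m : ℝ) ∈ Icc (0 : ℝ) (1 / 2) := by
  have : (2 : ℝ) ≤ m := by exact_mod_cast hm
  exact ⟨by positivity, one_div_le_one_div_of_le (by norm_num) this⟩

lemma differentiableOn_tsum_transTerm (k : ℕ+) (l : List ℕ+) (Q : ℕ) :
    DifferentiableOn ℂ (fun s => ∑' m, transTerm k l Q s m) {s | 3 - (Q : ℝ) < s.re} := by
  intro s₀ hs₀
  obtain ⟨σ, hσ, hσ₀⟩ := exists_between (show 3 - (Q : ℝ) < s₀.re from hs₀)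
  set U : Set ℂ := {s | σ < s.re} ∩ Metric.ball 0 (‖s₀‖ + 1) with hU
  have hUo : IsOpen U := (isOpen_halfPlane σ).inter Metric.isOpen_ball
  have hsU : s₀ ∈ U := ⟨hσ₀, by simp⟩
  obtain ⟨C, hC0, hC⟩ := exists_binomRem_bound Q (‖s₀‖ + 2)
  -- The exponent collects 1 from the linear bound on nested sums, 1 - σ from the power and -Q from
  -- the remainder; it is below -1 exactly when σ > 3 - Q.
  have hsum : Summable fun m : ℕ => C * (m : ℝ) ^ (2 - σ - Q) :=
    (Real.summable_nat_rpow.2 (by linarith)).mul_left C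
  refine DifferentiableAt.differentiableWithinAt
    (DifferentiableOn.differentiableAt (s := U) ?_ (hUo.mem_nhds hsU))
  refine Complex.differentiableOn_tsum_of_summable_norm hsum (fun m => ?_) hUo fun m s hs => ?_
  · rcases lt_or_ge m 2 with hm | hm
    · simp [transTerm, nestedSum_cons_eq_zero k l hm, differentiableOn_const]
    · have hm0 : (m : ℂ) ≠ 0 := by exact_mod_cast (by omega : m ≠ 0)
      intro s _
      refine DifferentiableAt.differentiableWithinAt (DifferentiableAt.const_mul
        (DifferentiableAt.mul ((differentiableAt_id.const_sub 1).const_cpow (Or.inl hm0)) ?_) _)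
      exact (differentiableAt_binomRem Q (x := 1 / m) (by linarith [(one_div_natCast_mem hm).2])
        (s - 1)).comp s (differentiableAt_id.sub_const 1)
  · rcases lt_or_ge m 2 with hm | hm
    · rw [transTerm, nestedSum_cons_eq_zero k l hm]
      simp only [Complex.ofReal_zero, zero_mul, norm_zero]
      positivity
    · have hm0 : (0 : ℝ) < m := by exact_mod_cast (by omega : 0 < m)
      have hm1 : (1 : ℝ) ≤ m := by exact_mod_cast (by omega : 1 ≤ m)
      have h1 : ‖(nestedSum (k :: l) m : ℂ)‖ ≤ (m : ℝ) := by
        rw [Complex.norm_real, Real.norm_of_nonneg (nestedSum_nonneg _ _)]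
        exact nestedSum_le _ (by omega)
      have h2 : ‖(m : ℂ) ^ (1 - s)‖ ≤ (m : ℝ) ^ (1 - σ) := by
        rw [Complex.norm_natCast_cpow_of_pos (by omega)]
        refine Real.rpow_le_rpow_of_exponent_le hm1 ?_
        have : σ < s.re := hs.1
        simp only [Complex.sub_re, Complex.one_re]
        linarith
      have h3 : ‖binomRem Q (s - 1) (1 / m)‖ ≤ C * (1 / m : ℝ) ^ Q := by
        refine hC _ ?_ _ (one_div_natCast_mem hm)
        have : ‖s‖ < ‖s₀‖ + 1 := by simpa using hs.2
        exact (norm_sub_le _ _).trans (by simp; linarith)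
      rw [transTerm, norm_mul, norm_mul]
      calc _ ≤ (m : ℝ) * ((m : ℝ) ^ (1 - σ) * (C * (1 / m : ℝ) ^ Q)) := by gcongr
        _ = C * ((m : ℝ) ^ (1 : ℝ) * (m : ℝ) ^ (1 - σ) * (m : ℝ) ^ (-(Q : ℝ))) := by
          rw [Real.rpow_one, Real.rpow_neg hm0.le, Real.rpow_natCast, one_div, inv_pow]
          ring
        _ = C * (m : ℝ) ^ (2 - σ - Q) := by
          rw [← Real.rpow_add hm0, ← Real.rpow_add hm0]
          ring_nf

lemma LSeriesSummable_of_abs_le {a : ℕ → ℝ} (ha : ∀ n, 1 ≤ n → |a n| ≤ n) {s : ℂ}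
    (hs : 2 < s.re) : LSeriesSummable (fun n => (a n : ℂ)) s :=
  LSeriesSummable_of_le_const_mul_rpow (x := 2) hs ⟨1, fun n hn => by
    rw [Complex.norm_real, Real.norm_eq_abs, one_mul]
    norm_num
    exact ha n (Nat.one_le_iff_ne_zero.2 hn)⟩

lemma LSeries_term_eq_mul_cpow {f : ℕ → ℂ} (hf : f 0 = 0) (s : ℂ) (n : ℕ) :
    LSeries.term f s n = f n * (n : ℂ) ^ (-s) := by
  rw [LSeries.term_def₀ hf]

/-- The translation formula. -/
lemma LSeries_translation (k : ℕ+) (l : List ℕ+) (Q : ℕ) {s : ℂ} (hs : 3 < s.re) :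
    LSeries (fun n => (nestedSum l n : ℂ)) (s - 1 + (k : ℕ)) =
      ∑ q ∈ Finset.range Q, pochCoeff (q + 1) (s - 1) *
        LSeries (fun n => (nestedSum (k :: l) n : ℂ)) (s + q) +
      ∑' m, transTerm k l (Q + 1) s m := by
  set A : ℕ → ℂ := fun n => (nestedSum (k :: l) n : ℂ) with hA
  have hA0 : A 0 = 0 := by simp [hA, nestedSum_cons_zero]
  have hAs : ∀ t : ℂ, 2 < t.re → LSeriesSummable A t := fun t ht =>
    LSeriesSummable_of_abs_le (fun n hn => by
      rw [abs_of_nonneg (nestedSum_nonneg _ _)]; exact nestedSum_le _ hn) ht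
  have hs1 : (2 : ℝ) < (s - 1).re := by simp; linarith
  have hsne : 1 - s ≠ 0 := fun h => by
    have : (1 - s).re = 0 := by rw [h]; rfl
    simp at this; linarith
  have hterm : ∀ n, LSeries.term A (s - 1) n = A n * (n : ℂ) ^ (1 - s) := fun n => by
    rw [LSeries_term_eq_mul_cpow hA0, neg_sub]
  have hS1 : Summable fun n => A n * (n : ℂ) ^ (1 - s) := (hAs _ hs1).congr fun n => hterm n
  have hα : ∀ n : ℕ, (polylogCoeff k l n : ℂ) * (n : ℂ) ^ (1 - s) =
      LSeries.term (fun n => (nestedSum l n : ℂ)) (s - 1 + (k : ℕ)) n := fun n => by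
    rcases Nat.eq_zero_or_pos n with rfl | hn
    · simp [polylogCoeff_zero]
    · have hn0 : (n : ℂ) ≠ 0 := by exact_mod_cast hn.ne'
      rw [LSeries.term_of_ne_zero hn.ne', polylogCoeff, Complex.cpow_add _ _ hn0,
        Complex.cpow_natCast, ← neg_sub s 1, Complex.cpow_neg]
      push_cast
      field_simp
  have hαs : Summable fun n : ℕ => (polylogCoeff k l n : ℂ) * (n : ℂ) ^ (1 - s) := by
    have hk : (1 : ℝ) ≤ (k : ℕ) := by exact_mod_cast k.pos
    refine Summable.congr (f := LSeries.term (fun n => (nestedSum l n : ℂ)) (s - 1 + (k : ℕ)))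
      (LSeriesSummable_of_abs_le (fun n hn => ?_) ?_) fun n => (hα n).symm
    · rw [abs_of_nonneg (nestedSum_nonneg _ _)]; exact nestedSum_le _ hn
    · simp only [Complex.add_re, Complex.natCast_re]; linarith
  have hAsucc : ∀ n, A (n + 1) = A n + polylogCoeff k l n := fun n => by
    simp only [hA, nestedSum_cons_succ]; push_cast; ring
  have hS2 : Summable fun n => A (n + 1) * (n : ℂ) ^ (1 - s) :=
    (hS1.add hαs).congr fun n => by rw [hAsucc]; ring
  -- Abel summation: polylogarithm coefficients are increments of A, and the difference is moved
  -- onto the power of n. The truncated predecessor at m = 0 is harmless because A 0 = 0.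
  set B : ℕ → ℂ := fun m => A m * (((m - 1 : ℕ) : ℂ) ^ (1 - s) - (m : ℂ) ^ (1 - s)) with hB
  have hB1 : HasSum B (∑' n, (polylogCoeff k l n : ℂ) * (n : ℂ) ^ (1 - s)) := by
    have h1 : HasSum (fun m => A m * ((m - 1 : ℕ) : ℂ) ^ (1 - s))
        (∑' n, A (n + 1) * (n : ℂ) ^ (1 - s)) := by
      rw [← hasSum_nat_add_iff' 1]
      simpa [hA0] using hS2.hasSum
    convert! h1.sub hS1.hasSum using 1
    · funext m; simp only [hB]; ring
    · rw [← hS2.tsum_sub hS1]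
      exact tsum_congr fun n => by rw [hAsucc]; ring
  have hBm : ∀ m, B m = ∑ q ∈ Finset.range Q, pochCoeff (q + 1) (s - 1) *
      LSeries.term A (s + q) m + transTerm k l (Q + 1) s m := fun m => by
    rcases lt_or_ge m 2 with hm | hm
    · have hAm : A m = 0 := by simp [hA, nestedSum_cons_eq_zero k l hm]
      have hT : ∀ q : ℕ, LSeries.term A (s + q) m = 0 := fun q => by
        rw [LSeries_term_eq_mul_cpow hA0, hAm, zero_mul]
      simp [hB, hAm, hT, transTerm, nestedSum_cons_eq_zero k l hm]
    · have hm0 : (0 : ℝ) < m := by exact_mod_cast (by omega : 0 < m)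
      have hmC : (m : ℂ) ≠ 0 := by exact_mod_cast hm0.ne'
      have hpow : ((m - 1 : ℕ) : ℂ) ^ (1 - s) =
          (m : ℂ) ^ (1 - s) * ((1 - 1 / m : ℝ) : ℂ) ^ (-(s - 1)) := by
        have he : ((m - 1 : ℕ) : ℂ) = ((m : ℝ) : ℂ) * ((1 - 1 / m : ℝ) : ℂ) := by
          rw [Nat.cast_sub (by omega)]
          push_cast
          field_simp
        rw [he, Complex.mul_cpow_ofReal_nonneg hm0.le
          (by linarith [(one_div_natCast_mem hm).2]), neg_sub]
        simp
      -- The constant term 1 is split off because it cancels in B; the remaining powers (1/m)^(q +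
      -- 1) turn m^(1 - s) into m^(-(s + q)).
      have hrem : ((1 - 1 / m : ℝ) : ℂ) ^ (-(s - 1)) = binomRem (Q + 1) (s - 1) (1 / m) +
          (∑ q ∈ Finset.range Q, pochCoeff (q + 1) (s - 1) * ((1 / m : ℝ) : ℂ) ^ (q + 1) + 1) := by
        rw [binomRem, Finset.sum_range_succ']
        simp [pochCoeff_zero]
      have hT : ∀ q : ℕ, LSeries.term A (s + q) m =
          A m * (m : ℂ) ^ (1 - s) * ((1 / m : ℝ) : ℂ) ^ (q + 1) := fun q => by
        rw [LSeries_term_eq_mul_cpow hA0, show -(s + q) = (1 - s) - ((q + 1 : ℕ) : ℂ) by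
          push_cast; ring, Complex.cpow_sub _ _ hmC, Complex.cpow_natCast]
        push_cast
        rw [one_div, inv_pow]
        ring
      simp only [hB, hpow, hrem, hT, transTerm]
      rw [mul_add, mul_add, Finset.mul_sum, mul_one]
      have : ∀ u v w : ℂ, A m * (u + (v + w) - w) = A m * v + A m * u := fun u v w => by ring
      rw [this, Finset.mul_sum]
      congr 1
      exact Finset.sum_congr rfl fun q _ => by ring
  have hq : ∀ q : ℕ, Summable (LSeries.term A (s + q)) := fun q => hAs _ (by
    simp only [Complex.add_re, Complex.natCast_re]
    have : (0 : ℝ) ≤ q := Nat.cast_nonneg q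
    linarith)
  have hfin : HasSum (fun m => ∑ q ∈ Finset.range Q, pochCoeff (q + 1) (s - 1) *
      LSeries.term A (s + q) m)
      (∑ q ∈ Finset.range Q, pochCoeff (q + 1) (s - 1) * LSeries A (s + q)) :=
    hasSum_sum fun q _ => (hq q).hasSum.mul_left _
  have hT : HasSum (transTerm k l (Q + 1) s) _ := (hB1.sub hfin).congr_fun (fun m => by
    rw [hBm m]; ring)
  rw [hT.tsum_eq, LSeries, ← tsum_congr hα]
  ring

/-! ### Meromorphic continuation of the zeta functions -/

lemma MeromorphicAt.comp_add_const {f : ℂ → ℂ} {s : ℂ} (a : ℂ) (hf : MeromorphicAt f (s + a)) :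
    MeromorphicAt (fun z => f (z + a)) s :=
  MeromorphicAt.comp_analyticAt (g := fun z => z + a) hf (by fun_prop)

lemma abscissaOfAbsConv_nestedSum_le (l : List ℕ+) :
    LSeries.abscissaOfAbsConv (fun n => (nestedSum l n : ℂ)) ≤ 1 := by
  have := LSeries.abscissaOfAbsConv_le_of_forall_lt_LSeriesSummable
    (f := fun n => (nestedSum l n : ℂ)) (x := 1) fun y hy =>
    LSeriesSummable_nestedSum l (by simpa using hy)
  exact_mod_cast this

lemma analyticAt_LSeries_nestedSum (l : List ℕ+) {s : ℂ} (hs : 1 < s.re) :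
    AnalyticAt ℂ (LSeries fun n => (nestedSum l n : ℂ)) s :=
  LSeries_analyticOnNhd _ s
    ((abscissaOfAbsConv_nestedSum_le l).trans_lt (by exact_mod_cast hs))

/-- Normal forms on the half-planes are glued; agreement with f, given only far to the right,
spreads to the whole region of analyticity by the identity theorem. -/
lemma exists_meromorphicContinuation_of_halfPlanes {f : ℂ → ℂ} {c d : ℝ}
    (hf : ∀ s : ℂ, c < s.re → AnalyticAt ℂ f s)
    (h : ∀ N : ℕ, ∃ F : ℂ → ℂ, MeromorphicOn F {s | d - N < s.re} ∧
      EqOn F f {s | max c d < s.re}) :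
    ∃ F, IsMeromorphicContinuation f {s | c < s.re} F := by
  choose F hF hFf using h
  have hd : ∀ (N : ℕ) (s : ℂ), max c d < s.re → d - N < s.re := fun N s hs => by
    have : (0 : ℝ) ≤ N := Nat.cast_nonneg N
    linarith [le_max_right c d]
  obtain ⟨G, hG, hGF⟩ := exists_glue_halfPlane (c := d) (d := max c d) (f := f)
    (F := fun N => toMeromorphicNFOn (F N) {s | d - N < s.re})
    (fun N => meromorphicNFOn_toMeromorphicNFOn _ _) fun N s hs => by
      have han : AnalyticAt ℂ (F N) s := by
        refine (hf s ((le_max_left c d).trans_lt hs)).congr ?_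
        filter_upwards [halfPlane_mem_nhds hs] with t ht
        exact (hFf N ht).symm
      exact (han.toMeromorphicNFOn_eq (hF N) (hd N s hs)).trans (hFf N hs)
  refine ⟨G, hG, ?_⟩
  have hfN : MeromorphicNFOn f {s | c < s.re} := fun s hs => (hf s hs).meromorphicNFAt
  have hz : max c d < ((max c d + 1 : ℝ) : ℂ).re := by simp
  refine MeromorphicNFOn.eqOn_of_isPreconnected (fun s _ => hG (mem_univ s)) hfN
    (isPreconnected_halfPlane c) (z := ((max c d + 1 : ℝ) : ℂ))
    ((le_max_left c d).trans_lt hz) ?_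
  filter_upwards [halfPlane_mem_nhds hz] with t ht
  rw [hGF 0 (hd 0 t ht)]
  have han : AnalyticAt ℂ (F 0) t := by
    refine (hf t ((le_max_left c d).trans_lt ht)).congr ?_
    filter_upwards [halfPlane_mem_nhds ht] with u hu
    exact (hFf 0 hu).symm
  exact (han.toMeromorphicNFOn_eq (hF 0) (hd 0 t ht)).trans (hFf 0 ht)

/-- At s = 1 the residue makes (s - 1) ζ(s) continuous with value 1, so its singularity is
removable. -/
lemma meromorphicAt_riemannZeta (s : ℂ) : MeromorphicAt riemannZeta s := by
  rcases eq_or_ne s 1 with rfl | hs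
  · set g : ℂ → ℂ := Function.update (fun s => (s - 1) * riemannZeta s) 1 1 with hg
    have hgne : ∀ z ≠ 1, g z = (z - 1) * riemannZeta z := fun z hz =>
      Function.update_of_ne hz _ _
    have han : AnalyticAt ℂ g 1 := by
      refine Complex.analyticAt_of_differentiable_on_punctured_nhds_of_continuousAt ?_ ?_
      · filter_upwards [self_mem_nhdsWithin] with z hz
        have hz' : ({1}ᶜ : Set ℂ) ∈ 𝓝 z := isOpen_compl_singleton.mem_nhds hz
        refine DifferentiableAt.congr_of_eventuallyEq (f := fun s => (s - 1) * riemannZeta s)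
          ((differentiableAt_id.sub_const 1).mul (differentiableAt_riemannZeta hz)) ?_
        filter_upwards [hz'] with w hw
        exact hgne w hw
      · exact continuousAt_update_same.2 riemannZeta_residue_one
    have hm : MeromorphicAt (fun z => g z / (z - 1)) 1 :=
      han.meromorphicAt.div (by fun_prop)
    refine hm.congr ?_
    filter_upwards [self_mem_nhdsWithin] with z hz
    have : z - 1 ≠ 0 := sub_ne_zero.2 hz
    rw [hgne z hz]
    field_simp
  · exact (analyticOn_riemannZeta s hs).meromorphicAt

lemma exists_continuation_step (k : ℕ+) (l : List ℕ+) {D : ℂ → ℂ} (hD : MeromorphicOn D univ)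
    (hDeq : EqOn D (LSeries fun n => (nestedSum l n : ℂ)) {s | 1 < s.re}) (N : ℕ) :
    ∃ F : ℂ → ℂ, MeromorphicOn F {s | 3 - (N : ℝ) < s.re} ∧
      EqOn F (LSeries fun n => (nestedSum (k :: l) n : ℂ)) {s | 3 < s.re} := by
  induction N with
  | zero =>
    refine ⟨LSeries fun n => (nestedSum (k :: l) n : ℂ), fun s hs => ?_, fun _ _ => rfl⟩
    refine (analyticAt_LSeries_nestedSum _ ?_).meromorphicAt
    have : 3 - ((0 : ℕ) : ℝ) < s.re := hs
    norm_num at this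
    linarith
  | succ N ih =>
    obtain ⟨F, hF, hFeq⟩ := ih
    -- The translation formula solved for its q = 0 term, whose coefficient is s - 1. All other
    -- arguments are shifted right by at least 1 and lie where F is already continued.
    refine ⟨fun s => (s - 1)⁻¹ * (D (s + (-1 + (k : ℕ))) -
      ∑ q ∈ Finset.range N, pochCoeff (q + 2) (s - 1) * F (s + ((q + 1 : ℕ) : ℂ)) -
      ∑' m, transTerm k l (N + 2) s m), fun s hs => ?_, fun s hs => ?_⟩
    · have hs' : 3 - ((N + 1 : ℕ) : ℝ) < s.re := hs
      push_cast at hs'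
      refine MeromorphicAt.fun_mul (MeromorphicAt.fun_inv (by fun_prop)) (MeromorphicAt.fun_sub
        (MeromorphicAt.fun_sub ((hD _ (mem_univ _)).comp_add_const _) ?_) ?_)
      · refine MeromorphicAt.fun_sum fun q _ => ?_
        refine MeromorphicAt.fun_mul ?_ ((hF _ ?_).comp_add_const _)
        · exact (Differentiable.analyticAt ((differentiable_pochCoeff (q + 2)).comp
            (differentiable_id.sub_const 1)) s).meromorphicAt
        · show 3 - (N : ℝ) < (s + ((q + 1 : ℕ) : ℂ)).re
          have : (0 : ℝ) ≤ q := Nat.cast_nonneg q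
          rw [Complex.add_re, Complex.natCast_re]
          push_cast
          linarith
      · refine ((differentiableOn_tsum_transTerm k l (N + 2)).analyticAt ?_).meromorphicAt
        refine halfPlane_mem_nhds ?_
        push_cast
        linarith
    · have hs3 : (3 : ℝ) < s.re := hs
      have hs1 : s - 1 ≠ 0 := sub_ne_zero.2 fun h => by
        rw [h, Complex.one_re] at hs3; linarith
      have h := LSeries_translation k l (N + 1) hs3
      rw [Finset.sum_range_succ'] at h
      have hk : (1 : ℝ) ≤ (k : ℕ) := by exact_mod_cast k.pos
      have hDs : D (s + (-1 + (k : ℕ))) =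
          LSeries (fun n => (nestedSum l n : ℂ)) (s - 1 + (k : ℕ)) := by
        rw [hDeq (show 1 < (s + (-1 + (k : ℕ)) : ℂ).re by
          simp only [Complex.add_re, Complex.natCast_re, Complex.neg_re, Complex.one_re]
          linarith)]
        ring_nf
      have hFs : ∀ q : ℕ, F (s + ((q + 1 : ℕ) : ℂ)) =
          LSeries (fun n => (nestedSum (k :: l) n : ℂ)) (s + ((q + 1 : ℕ) : ℂ)) := fun q =>
        hFeq (show 3 < (s + ((q + 1 : ℕ) : ℂ)).re by
          have : (0 : ℝ) ≤ ((q + 1 : ℕ) : ℝ) := Nat.cast_nonneg _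
          rw [Complex.add_re, Complex.natCast_re]
          linarith)
      simp only [hDs, hFs]
      rw [h, zero_add, pochCoeff_one, Nat.cast_zero, add_zero]
      field_simp
      ring

theorem exists_isMeromorphicContinuation_LSeries (l : List ℕ+) :
    ∃ F, IsMeromorphicContinuation (LSeries fun n => (nestedSum l n : ℂ)) {s | 1 < s.re} F := by
  induction l with
  | nil =>
    refine exists_meromorphicContinuation_of_halfPlanes (d := 1)
      (fun s hs => analyticAt_LSeries_nestedSum _ hs) fun N =>
        ⟨riemannZeta, fun s _ => meromorphicAt_riemannZeta s, fun s hs => ?_⟩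
    have hs' : 1 < s.re := by simpa using hs
    rw [← LSeries_one_eq_riemannZeta hs']
    congr 1
  | cons k l ih =>
    obtain ⟨D, hD, hDeq⟩ := ih
    refine exists_meromorphicContinuation_of_halfPlanes (d := 3)
      (fun s hs => analyticAt_LSeries_nestedSum _ hs) fun N => ?_
    rw [max_eq_right (by norm_num)]
    exact exists_continuation_step k l hD.meromorphicOn hDeq N

theorem multiZetaFunction_spec (l : MZIndex) : MeromorphicNFOn (multiZetaFunction l) univ ∧
    ∀ s : ℂ, 1 < s.re → Summable (multiZetaTerm l s) ∧ AnalyticAt ℂ (multiZetaFunction l) s ∧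
      multiZetaFunction l s = multiZetaSeries l s ∧
      multiZetaFunction l s = LSeries (fun n => (nestedSum l.reverse n : ℂ)) s := by
  have hsum : ∀ s : ℂ, 1 < s.re → HasSum (multiZetaTerm l s)
      (LSeries (fun n => (nestedSum l.reverse n : ℂ)) s) := fun s hs =>
    hasSum_multiZetaTerm l (fun h => by rw [h, Complex.zero_re] at hs; linarith)
      (LSeriesSummable_nestedSum _ hs)
  obtain ⟨F, hF, hFeq⟩ := exists_isMeromorphicContinuation_LSeries l.reverse
  have hspec := meromorphicContinuation_spec (f := multiZetaSeries l) (U := {s | 1 < s.re})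
    ⟨F, hF, fun s hs => (hFeq hs).trans (hsum s hs).tsum_eq.symm⟩
  refine ⟨hspec.1, fun s hs => ⟨(hsum s hs).summable, ?_, hspec.2 hs,
    (hspec.2 hs).trans (hsum s hs).tsum_eq⟩⟩
  refine (analyticAt_LSeries_nestedSum l.reverse hs).congr ?_
  filter_upwards [halfPlane_mem_nhds hs] with t ht
  exact ((hspec.2 ht).trans (hsum t ht).tsum_eq).symm

/-! ### Kernels, their growth and Mellin transforms -/

lemma wordPolylog_le_one (l : List ℕ+) {z : ℝ} (hz0 : 0 ≤ z) (hz : z ≤ 1 / 2) :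
    wordPolylog l z ≤ 1 := by
  rcases l with _ | ⟨k, l⟩
  · exact le_rfl
  · refine (wordPolylog_cons_le k l hz0 (by linarith)).trans ?_
    rw [div_le_one (by linarith)]
    linarith

lemma isBigO_of_mem_logPolylogSpan {n : ℕ} {f : ℝ → ℝ} (hf : f ∈ logPolylogSpan n) {ε : ℝ}
    (hε : 0 < ε) : f =O[𝓝[>] 0] fun z : ℝ => z ^ (-ε) := by
  induction hf using Submodule.span_induction with
  | mem f hf =>
    obtain ⟨u, j, l, h, a, ha, rfl⟩ := hf
    refine IsBigO.const_mul_left ?_ a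
    have h1 : (fun z => logPow j z * wordPolylog l z) =O[𝓝[>] 0]
        fun z => |Real.log z| ^ (j : ℝ) := by
      refine IsBigO.of_bound 1 ?_
      filter_upwards [Ioo_mem_nhdsGT (show (0 : ℝ) < 1 / 2 by norm_num)] with z hz
      rw [norm_mul, Real.norm_of_nonneg (wordPolylog_nonneg _ hz.1.le), Real.rpow_natCast,
        Real.norm_of_nonneg (by positivity : (0 : ℝ) ≤ |Real.log z| ^ j), one_mul]
      refine (mul_le_of_le_one_right (norm_nonneg _)
        (wordPolylog_le_one l hz.1.le hz.2.le)).trans ?_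
      rw [logPow, norm_div, norm_pow, norm_neg, Real.norm_eq_abs, Real.norm_natCast]
      exact div_le_self (by positivity)
        (by exact_mod_cast Nat.one_le_iff_ne_zero.2 j.factorial_ne_zero)
    exact h1.trans (isLittleO_abs_log_rpow_rpow_nhdsGT_zero (j : ℝ) (neg_lt_zero.2 hε)).isBigO
  | zero => exact isBigO_zero _ _
  | add f g _ _ hf hg => exact hf.add hg
  | smul c f _ hf =>
    have : c • f = fun z => (c : ℝ) * f z := funext fun z => by simp [Rat.smul_def]
    rw [this]
    exact hf.const_mul_left _

/-- Reflection shows that a polylogarithm has at most logarithmic growth at 1. This controls the ξ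
kernel at infinity and the zeta kernel at 0. -/
lemma wordPolylog_one_sub_isBigO (w : List ℕ+) {ε : ℝ} (hε : 0 < ε) :
    (fun z => wordPolylog w (1 - z)) =O[𝓝[>] 0] fun z : ℝ => z ^ (-ε) := by
  obtain ⟨f, hf, hfz⟩ := hasReflection w
  refine (isBigO_of_mem_logPolylogSpan hf hε).congr' ?_ EventuallyEq.rfl
  filter_upwards [Ioo_mem_nhdsGT (zero_lt_one (α := ℝ))] with z hz
  exact (hfz z hz).symm

lemma exp_neg_mem_Ioo {t : ℝ} (ht : 0 < t) : Real.exp (-t) ∈ Ioo (0 : ℝ) 1 :=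
  ⟨Real.exp_pos _, (Real.exp_lt_exp.2 (neg_lt_zero.2 ht)).trans_eq Real.exp_zero⟩

lemma abs_one_sub_exp_neg_lt {t : ℝ} (ht : 0 < t) : |1 - Real.exp (-t)| < 1 := by
  have := exp_neg_mem_Ioo ht
  rw [abs_lt]
  constructor <;> linarith [this.1, this.2]

lemma exp_sub_one_pos {t : ℝ} (ht : 0 < t) : 0 < Real.exp t - 1 :=
  sub_pos.2 (Real.one_lt_exp_iff.2 ht)

lemma tendsto_exp_neg_nhdsGT : Tendsto (fun t : ℝ => Real.exp (-t)) atTop (𝓝[>] 0) :=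
  tendsto_nhdsWithin_iff.2 ⟨Real.tendsto_exp_neg_atTop_nhds_zero,
    Eventually.of_forall fun _ => Real.exp_pos _⟩

lemma tendsto_one_sub_exp_neg : Tendsto (fun t : ℝ => 1 - Real.exp (-t)) (𝓝[>] 0) (𝓝[>] 0) := by
  refine tendsto_nhdsWithin_iff.2 ⟨?_, ?_⟩
  · have : Tendsto (fun t : ℝ => 1 - Real.exp (-t)) (𝓝 0) (𝓝 (1 - Real.exp (-0))) :=
      Continuous.tendsto (by fun_prop) 0
    simp only [neg_zero, Real.exp_zero, sub_self] at this
    exact this.mono_left nhdsWithin_le_nhds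
  · filter_upwards [self_mem_nhdsWithin] with t ht
    exact sub_pos.2 (exp_neg_mem_Ioo ht).2

/-- The kernel `Li_w(1 - e ^ (-t)) / (e ^ t - 1)`. -/
noncomputable def xiKernel (w : List ℕ+) (t : ℝ) : ℝ :=
  wordPolylog w (1 - Real.exp (-t)) / (Real.exp t - 1)

/-- The kernel `Li_w(e ^ (-t)) / (e ^ t - 1)`. -/
noncomputable def zetaKernel (w : List ℕ+) (t : ℝ) : ℝ :=
  wordPolylog w (Real.exp (-t)) / (Real.exp t - 1)

lemma continuousOn_xiKernel (w : List ℕ+) : ContinuousOn (xiKernel w) (Ioi 0) := by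
  intro t ht
  refine ContinuousAt.continuousWithinAt (ContinuousAt.div ?_ (by fun_prop)
    (exp_sub_one_pos ht).ne')
  exact ContinuousAt.comp (f := fun t : ℝ => 1 - Real.exp (-t)) (g := wordPolylog w)
    (differentiableAt_wordPolylog w (abs_one_sub_exp_neg_lt ht)).continuousAt (by fun_prop)

lemma continuousOn_zetaKernel (w : List ℕ+) : ContinuousOn (zetaKernel w) (Ioi 0) := by
  intro t ht
  refine ContinuousAt.continuousWithinAt (ContinuousAt.div ?_ (by fun_prop)
    (exp_sub_one_pos ht).ne')
  have h := exp_neg_mem_Ioo ht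
  exact ContinuousAt.comp (f := fun t : ℝ => Real.exp (-t)) (g := wordPolylog w)
    (differentiableAt_wordPolylog w (by rw [abs_of_pos h.1]; exact h.2)).continuousAt (by fun_prop)

lemma inv_exp_sub_one_isBigO_top :
    (fun t : ℝ => (Real.exp t - 1)⁻¹) =O[atTop] fun t => Real.exp (-1 * t) := by
  refine IsBigO.of_bound 2 ?_
  filter_upwards [eventually_ge_atTop 1] with t ht
  have h2 : 2 ≤ Real.exp t := by linarith [Real.add_one_le_exp t]
  rw [Real.norm_of_nonneg (by rw [inv_nonneg]; linarith), Real.norm_of_nonneg (Real.exp_pos _).le,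
    neg_one_mul, Real.exp_neg, ← div_eq_mul_inv, inv_eq_one_div,
    div_le_div_iff₀ (by linarith) (by linarith)]
  linarith

/-- The choice ε = 1/2 costs a factor e^(t/2) against the decay e^(-t) of 1/(e^t - 1). -/
lemma xiKernel_isBigO_top (w : List ℕ+) :
    xiKernel w =O[atTop] fun t => Real.exp (-(1 / 2) * t) := by
  have h := (wordPolylog_one_sub_isBigO w (ε := 1 / 2) (by norm_num)).comp_tendsto
    tendsto_exp_neg_nhdsGT
  refine (h.mul inv_exp_sub_one_isBigO_top).congr (fun t => by
    simp [xiKernel, div_eq_mul_inv]) fun t => ?_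
  rw [Function.comp_apply, ← Real.exp_mul, ← Real.exp_add]
  congr 1
  ring

lemma zetaKernel_isBigO_top (w : List ℕ+) :
    zetaKernel w =O[atTop] fun t => Real.exp (-1 * t) := by
  have h : (fun t => wordPolylog w (Real.exp (-t))) =O[atTop] fun _ => (1 : ℝ) := by
    refine IsBigO.of_bound 1 ?_
    have h0 : ∀ᶠ z : ℝ in 𝓝[>] 0, z ∈ Ioo (0 : ℝ) (1 / 2) := Ioo_mem_nhdsGT (by norm_num)
    filter_upwards [tendsto_exp_neg_nhdsGT.eventually h0] with t ht
    rw [Real.norm_of_nonneg (wordPolylog_nonneg _ ht.1.le), norm_one, mul_one]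
    exact wordPolylog_le_one w ht.1.le ht.2.le
  refine (h.mul inv_exp_sub_one_isBigO_top).congr (fun t => ?_) fun t => one_mul _
  rw [zetaKernel, div_eq_mul_inv]

lemma zetaKernel_isBigO_zero (w : List ℕ+) {ε : ℝ} (hε : 0 < ε) :
    zetaKernel w =O[𝓝[>] 0] fun t : ℝ => t ^ (-(1 + ε)) := by
  have h := (wordPolylog_one_sub_isBigO w hε).comp_tendsto tendsto_one_sub_exp_neg
  have h2 : ((fun z : ℝ => z ^ (-ε)) ∘ fun t : ℝ => 1 - Real.exp (-t)) =O[𝓝[>] 0]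
      fun t : ℝ => t ^ (-ε) := by
    refine IsBigO.of_bound (2 ^ ε) ?_
    filter_upwards [Ioo_mem_nhdsGT (zero_lt_one (α := ℝ))] with t ht
    -- A negative power of 1 - e^(-t) is to be bounded by one of t, so a lower bound is needed.
    have hle : t / 2 ≤ 1 - Real.exp (-t) := by
      have h3 : Real.exp (-t) ≤ (1 + t)⁻¹ := by
        rw [Real.exp_neg]
        exact inv_anti₀ (by linarith [ht.1]) (by linarith [Real.add_one_le_exp t])
      have h4 : (1 + t)⁻¹ ≤ 1 - t / 2 := by
        rw [inv_le_iff_one_le_mul₀ (by linarith [ht.1])]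
        nlinarith [ht.1, ht.2]
      linarith
    have ht2 : 0 < t / 2 := by linarith [ht.1]
    rw [Function.comp_apply, Real.norm_of_nonneg (Real.rpow_nonneg (ht2.le.trans hle) _),
      Real.norm_of_nonneg (Real.rpow_nonneg ht.1.le _)]
    refine (Real.rpow_le_rpow_of_nonpos ht2 hle (by linarith)).trans_eq ?_
    rw [Real.div_rpow ht.1.le (by norm_num), Real.rpow_neg (by norm_num : (0 : ℝ) ≤ 2), div_inv_eq_mul]
    ring
  have h3 : (fun t : ℝ => (Real.exp t - 1)⁻¹) =O[𝓝[>] 0] fun t : ℝ => t ^ (-1 : ℝ) := by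
    refine IsBigO.of_bound 1 ?_
    filter_upwards [self_mem_nhdsWithin] with t ht
    have ht' : 0 < t := ht
    rw [Real.rpow_neg_one, Real.norm_of_nonneg (inv_nonneg.2 (exp_sub_one_pos ht).le),
      Real.norm_of_nonneg (inv_nonneg.2 ht'.le), one_mul]
    exact inv_anti₀ ht' (by linarith [Real.add_one_le_exp t])
  refine ((h.trans h2).mul h3).congr' ?_ ?_
  · filter_upwards with t
    rw [Function.comp_apply, sub_sub_cancel, zetaKernel, div_eq_mul_inv]
  · filter_upwards [self_mem_nhdsWithin] with t ht
    rw [← Real.rpow_add ht]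
    congr 1
    ring

lemma ContinuousOn.locallyIntegrableOn_ofReal {f : ℝ → ℝ} (hf : ContinuousOn f (Ioi 0)) :
    LocallyIntegrableOn (fun t => (f t : ℂ)) (Ioi 0) :=
  ContinuousOn.locallyIntegrableOn (Complex.continuous_ofReal.comp_continuousOn hf)
    measurableSet_Ioi

lemma mellinConvergent_zetaKernel (w : List ℕ+) {s : ℂ} (hs : 1 < s.re) :
    MellinConvergent (fun t => (zetaKernel w t : ℂ)) s :=
  mellinConvergent_of_isBigO_rpow_exp (b := 1 + (s.re - 1) / 2) one_pos
    (continuousOn_zetaKernel w).locallyIntegrableOn_ofReal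
    (Complex.isBigO_ofReal_left.2 (zetaKernel_isBigO_top w))
    (Complex.isBigO_ofReal_left.2 (zetaKernel_isBigO_zero w (by linarith))) (by linarith)

/-- Here Li_w(x) / (e^t - 1) at x = e^(-t) equals x Li_w(x) / (1 - x), which the generating function
of nested sums expands into exponentials e^(-(n + 1)t). Each is transformed separately. -/
lemma mellin_zetaKernel (w : List ℕ+) {s : ℂ} (hs : 1 < s.re) :
    mellin (fun t => (zetaKernel w t : ℂ)) s =
      Complex.Gamma s * LSeries (fun n => (nestedSum w n : ℂ)) s := by
  have hsr : 0 < s.re := by linarith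
  have hs0 : s ≠ 0 := fun h => by rw [h] at hsr; exact lt_irrefl _ hsr
  have hL := LSeriesSummable_nestedSum w hs
  have hterm : ∀ n : ℕ, LSeries.term (fun n => (nestedSum w n : ℂ)) s n =
      (nestedSum w n : ℂ) / ((n : ℝ) : ℂ) ^ s := fun n => by
    rw [LSeries.term_of_ne_zero' hs0]; rfl
  have h0 : LSeries.term (fun n => (nestedSum w n : ℂ)) s 0 = 0 := LSeries.term_zero _ _
  have h := hasSum_mellin (ι := ℕ) (a := fun n => (nestedSum w (n + 1) : ℂ))
    (p := fun n => ((n + 1 : ℕ) : ℝ)) (F := fun t => (zetaKernel w t : ℂ)) (s := s)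
    (fun n => Or.inr (by positivity)) hsr (fun t ht => ?_) ?_
  · rw [← h.tsum_eq, LSeries, hL.tsum_eq_zero_add, h0, zero_add, ← tsum_mul_left]
    exact tsum_congr fun n => by rw [hterm, mul_div_assoc]
  · have hx := exp_neg_mem_Ioo (show 0 < t from ht)
    have hx' : |Real.exp (-t)| < 1 := by rw [abs_of_pos hx.1]; exact hx.2
    have h1 := (summable_nestedSum_mul_pow w hx').hasSum.mul_left (Real.exp (-t))
    rw [tsum_nestedSum_mul_pow w hx'] at h1
    have h2 : Real.exp (-t) * (wordPolylog w (Real.exp (-t)) / (1 - Real.exp (-t))) =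
        zetaKernel w t := by
      have h3 : Real.exp t * Real.exp (-t) = 1 := by rw [← Real.exp_add]; simp
      have h4 : Real.exp t - 1 ≠ 0 := (exp_sub_one_pos ht).ne'
      have h5 : 1 - Real.exp (-t) ≠ 0 := by linarith [hx.2]
      rw [zetaKernel]
      field_simp
      linear_combination wordPolylog w (Real.exp (-t)) * h3
    rw [h2] at h1
    refine (Complex.hasSum_ofReal.2 h1).congr_fun fun n => ?_
    rw [← Complex.ofReal_mul]
    congr 1
    rw [← Real.exp_nat_mul, mul_left_comm, ← Real.exp_add]
    congr 2
    push_cast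
    ring
  · have hn := ((summable_nat_add_iff 1).2 hL.norm)
    refine hn.congr fun n => ?_
    rw [hterm, norm_div, Complex.norm_cpow_eq_rpow_re_of_pos (by positivity)]

/-! ### Entire continuation of ξ -/

lemma nestedSum_cons_eq_zero_of_le (k : ℕ+) (l : List ℕ+) {m : ℕ} (hm : m ≤ l.length + 1) :
    nestedSum (k :: l) m = 0 := by
  induction l generalizing k m with
  | nil => exact nestedSum_cons_eq_zero k [] (by simp at hm; omega)
  | cons k' l ih =>
    rw [nestedSum_cons]
    refine Finset.sum_eq_zero fun n hn => ?_
    have hn' := Finset.mem_range.1 hn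
    rw [polylogCoeff, ih k' (by simp at hm; omega), zero_div]

/-- A word of depth r needs a largest index of at least r. The resulting zero of order r - 1 of the
kernel at t = 0 accounts for the region Re s > 1 - r. -/
lemma polylogCoeff_eq_zero_of_le (k : ℕ+) (l : List ℕ+) {n : ℕ} (hn : n ≤ l.length) :
    polylogCoeff k l n = 0 := by
  rcases l with _ | ⟨k', l⟩
  · rw [Nat.le_zero.1 hn, polylogCoeff_zero]
  · rw [polylogCoeff, nestedSum_cons_eq_zero_of_le k' l (by simpa using hn), zero_div]

lemma wordPolylog_sub_sum_bounds (k : ℕ+) (l : List ℕ+) (N : ℕ) {x : ℝ} (hx0 : 0 ≤ x) (hx : x < 1) :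
    |wordPolylog (k :: l) x - ∑ n ∈ Finset.range N, polylogCoeff k l (n + 1) * x ^ (n + 1)| ≤
      x ^ (N + 1) / (1 - x) := by
  have hx' : |x| < 1 := by rwa [abs_of_nonneg hx0]
  have hs := summable_polylog k l hx'
  have h : ∑ n ∈ Finset.range N, polylogCoeff k l (n + 1) * x ^ (n + 1) +
      ∑' n, polylogCoeff k l (n + (N + 1)) * x ^ (n + (N + 1)) = wordPolylog (k :: l) x := by
    have h1 := hs.sum_add_tsum_nat_add (N + 1)
    rw [Finset.sum_range_succ', polylogCoeff_zero, zero_mul, add_zero] at h1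
    rw [wordPolylog]
    exact h1
  have h2 : 0 ≤ ∑' n, polylogCoeff k l (n + (N + 1)) * x ^ (n + (N + 1)) :=
    tsum_nonneg fun n => mul_nonneg (polylogCoeff_nonneg _ _ _) (by positivity)
  have h3 : ∑' n, x ^ (N + 1) * x ^ n = x ^ (N + 1) / (1 - x) := by
    rw [tsum_mul_left, tsum_geometric_of_abs_lt_one hx', div_eq_mul_inv]
  have hs' : Summable fun n => polylogCoeff k l (n + (N + 1)) * x ^ (n + (N + 1)) :=
    (summable_nat_add_iff (f := fun n => polylogCoeff k l n * x ^ n) (N + 1)).2 hs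
  have hg : Summable fun n => x ^ (N + 1) * x ^ n :=
    (summable_geometric_of_lt_one hx0 hx).mul_left _
  have hle : ∀ n, polylogCoeff k l (n + (N + 1)) * x ^ (n + (N + 1)) ≤ x ^ (N + 1) * x ^ n :=
    fun n => by
      rw [← pow_add, add_comm (N + 1) n]
      exact mul_le_of_le_one_left (pow_nonneg hx0 _) (polylogCoeff_le_one _ _ _)
  rw [← h, add_sub_cancel_left, abs_of_nonneg h2, ← h3]
  exact hs'.tsum_le_tsum hle hg

/-- The kernel `e ^ (-t) * (1 - e ^ (-t)) ^ n`. -/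
noncomputable def expKernel (n : ℕ) (t : ℝ) : ℝ := Real.exp (-t) * (1 - Real.exp (-t)) ^ n

lemma continuous_expKernel (n : ℕ) : Continuous (expKernel n) := by
  unfold expKernel
  fun_prop

lemma abs_expKernel_le (n : ℕ) {t : ℝ} (ht : 0 < t) : |expKernel n t| ≤ Real.exp (-t) := by
  have h := exp_neg_mem_Ioo ht
  rw [expKernel, abs_mul, abs_of_pos h.1, abs_pow]
  exact mul_le_of_le_one_right h.1.le (pow_le_one₀ (abs_nonneg _) (abs_one_sub_exp_neg_lt ht).le)

lemma expKernel_isBigO_top (n : ℕ) : expKernel n =O[atTop] fun t => Real.exp (-1 * t) := by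
  refine IsBigO.of_bound 1 ?_
  filter_upwards [eventually_gt_atTop 0] with t ht
  rw [one_mul, Real.norm_eq_abs, Real.norm_of_nonneg (Real.exp_pos _).le, neg_one_mul]
  exact abs_expKernel_le n ht

lemma mellinConvergent_expKernel (n : ℕ) {s : ℂ} (hs : 0 < s.re) :
    MellinConvergent (fun t => (expKernel n t : ℂ)) s := by
  refine mellinConvergent_of_isBigO_rpow_exp (b := 0) one_pos
    (continuous_expKernel n).continuousOn.locallyIntegrableOn_ofReal
    (Complex.isBigO_ofReal_left.2 (expKernel_isBigO_top n))
    (Complex.isBigO_ofReal_left.2 (IsBigO.of_bound 1 ?_)) hs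
  filter_upwards [self_mem_nhdsWithin] with t ht
  rw [neg_zero, Real.rpow_zero, norm_one, mul_one]
  exact (abs_expKernel_le n ht).trans (exp_neg_mem_Ioo ht).2.le

/-- The entire function `∑ (-1) ^ j * binom(n, j) * (j + 1) ^ (-s)`. -/
noncomputable def binomDirichlet (n : ℕ) (s : ℂ) : ℂ :=
  ∑ j : Fin (n + 1), ((-1) ^ (j : ℕ) * (n.choose j : ℂ)) / (((j + 1 : ℕ) : ℝ) : ℂ) ^ s

lemma differentiable_binomDirichlet (n : ℕ) : Differentiable ℂ (binomDirichlet n) := by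
  refine Differentiable.fun_sum fun j _ => ?_
  have h0 : (((j + 1 : ℕ) : ℝ) : ℂ) ≠ 0 := by
    rw [Complex.ofReal_ne_zero]; positivity
  refine (differentiable_const _).div (differentiable_id.const_cpow (Or.inl h0)) fun s => ?_
  rw [Complex.cpow_ne_zero_iff]
  exact Or.inl h0

/-- Binomial expansion writes the kernel as a finite sum of exponentials e^(-(j + 1)t), so the
transform divided by Γ is entire. -/
lemma mellin_expKernel (n : ℕ) {s : ℂ} (hs : 0 < s.re) :
    mellin (fun t => (expKernel n t : ℂ)) s = Complex.Gamma s * binomDirichlet n s := by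
  have h := hasSum_mellin (ι := Fin (n + 1)) (a := fun j => (-1) ^ (j : ℕ) * (n.choose j : ℂ))
    (p := fun j => ((j + 1 : ℕ) : ℝ)) (F := fun t => (expKernel n t : ℂ)) (s := s)
    (fun n => Or.inr (by positivity)) hs (fun t _ => ?_) Summable.of_finite
  · rw [← h.tsum_eq, tsum_fintype, binomDirichlet, Finset.mul_sum]
    exact Finset.sum_congr rfl fun j _ => by rw [mul_div_assoc]
  · convert! hasSum_fintype (L := .unconditional _) _ using 1
    have hexp : expKernel n t = ∑ j ∈ Finset.range (n + 1),
        ((-1) ^ j * (n.choose j : ℝ)) * Real.exp (-((j + 1 : ℕ) : ℝ) * t) := by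
      rw [expKernel, show 1 - Real.exp (-t) = -Real.exp (-t) + 1 by ring, add_pow, Finset.mul_sum]
      refine Finset.sum_congr rfl fun j _ => ?_
      rw [show -((j + 1 : ℕ) : ℝ) * t = -t + j * (-t) by push_cast; ring, Real.exp_add,
        Real.exp_nat_mul, neg_pow]
      ring
    rw [hexp, Finset.sum_range]
    push_cast
    rfl

/-- The kernel of `ξ` minus the first `N` terms of its expansion in powers of `1 - e ^ (-t)`. -/
noncomputable def xiRem (k : ℕ+) (l : List ℕ+) (N : ℕ) (t : ℝ) : ℝ :=
  xiKernel (k :: l) t - ∑ n ∈ Finset.range N, polylogCoeff k l (n + 1) * expKernel n t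

/-- With x = 1 - e^(-t), 1/(e^t - 1) is (1 - x)/x, so x^(n + 1) contributes exactly `expKernel n`.
What is left is (1 - x)/x times a power series tail of size at most x^(N + 1)/(1 - x), and x ≤ t. -/
lemma abs_xiRem_le (k : ℕ+) (l : List ℕ+) (N : ℕ) {t : ℝ} (ht : 0 < t) :
    |xiRem k l N t| ≤ t ^ N := by
  have h := exp_neg_mem_Ioo ht
  set x := 1 - Real.exp (-t) with hx
  have hx0 : 0 < x := by linarith [h.2]
  have hx1 : x < 1 := by linarith [h.1]
  have hxt : x ≤ t := by linarith [Real.one_sub_le_exp_neg t]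
  have he : Real.exp t - 1 = x / (1 - x) := by
    have h3 : Real.exp t * Real.exp (-t) = 1 := by rw [← Real.exp_add]; simp
    rw [eq_div_iff (by linarith), hx]
    linear_combination h3
  have hrem : xiRem k l N t = (1 - x) / x * (wordPolylog (k :: l) x -
      ∑ n ∈ Finset.range N, polylogCoeff k l (n + 1) * x ^ (n + 1)) := by
    rw [xiRem, xiKernel, he, mul_sub, Finset.mul_sum, ← hx]
    congr 1
    · field_simp
    · refine Finset.sum_congr rfl fun n _ => ?_
      rw [expKernel, ← hx, show Real.exp (-t) = 1 - x by rw [hx]; ring, pow_succ]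
      field_simp
  have h1x : 0 < 1 - x := by linarith
  rw [hrem, abs_mul, abs_of_pos (div_pos h1x hx0)]
  calc _ ≤ (1 - x) / x * (x ^ (N + 1) / (1 - x)) := by
        gcongr
        exact wordPolylog_sub_sum_bounds k l N hx0.le hx1
    _ = x ^ N := by rw [pow_succ]; field_simp
    _ ≤ t ^ N := by gcongr

lemma continuousOn_xiRem (k : ℕ+) (l : List ℕ+) (N : ℕ) : ContinuousOn (xiRem k l N) (Ioi 0) :=
  (continuousOn_xiKernel _).sub (Continuous.continuousOn (continuous_finsetSum _ fun n _ =>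
    (continuous_expKernel n).const_mul _))

lemma xiRem_isBigO_top (k : ℕ+) (l : List ℕ+) (N : ℕ) :
    xiRem k l N =O[atTop] fun t => Real.exp (-(1 / 2) * t) := by
  refine (xiKernel_isBigO_top _).sub (IsBigO.fun_sum fun n _ => IsBigO.const_mul_left ?_ _)
  refine (expKernel_isBigO_top n).trans (IsBigO.of_bound 1 ?_)
  filter_upwards [eventually_gt_atTop 0] with t ht
  rw [one_mul, Real.norm_of_nonneg (Real.exp_pos _).le, Real.norm_of_nonneg (Real.exp_pos _).le]
  exact Real.exp_le_exp.2 (by linarith)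

lemma xiRem_isBigO_zero (k : ℕ+) (l : List ℕ+) (N : ℕ) :
    xiRem k l N =O[𝓝[>] 0] fun t : ℝ => t ^ (-(-(N : ℝ))) := by
  refine IsBigO.of_bound 1 ?_
  filter_upwards [self_mem_nhdsWithin] with t ht
  have ht' : 0 < t := ht
  rw [neg_neg, Real.rpow_natCast, one_mul, Real.norm_of_nonneg (by positivity : 0 ≤ t ^ N)]
  exact abs_xiRem_le k l N ht

lemma mellinConvergent_xiRem (k : ℕ+) (l : List ℕ+) (N : ℕ) {s : ℂ} (hs : -(N : ℝ) < s.re) :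
    MellinConvergent (fun t => (xiRem k l N t : ℂ)) s :=
  mellinConvergent_of_isBigO_rpow_exp one_half_pos
    (continuousOn_xiRem k l N).locallyIntegrableOn_ofReal
    (Complex.isBigO_ofReal_left.2 (xiRem_isBigO_top k l N))
    (Complex.isBigO_ofReal_left.2 (xiRem_isBigO_zero k l N)) hs

lemma differentiableAt_mellin_xiRem (k : ℕ+) (l : List ℕ+) (N : ℕ) {s : ℂ}
    (hs : -(N : ℝ) < s.re) :
    DifferentiableAt ℂ (mellin fun t => (xiRem k l N t : ℂ)) s :=
  mellin_differentiableAt_of_isBigO_rpow_exp one_half_pos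
    (continuousOn_xiRem k l N).locallyIntegrableOn_ofReal
    (Complex.isBigO_ofReal_left.2 (xiRem_isBigO_top k l N))
    (Complex.isBigO_ofReal_left.2 (xiRem_isBigO_zero k l N)) hs

lemma mellin_finset_sum {ι : Type*} {I : Finset ι} {f : ι → ℝ → ℂ} {s : ℂ}
    (h : ∀ i ∈ I, MellinConvergent (f i) s) :
    mellin (fun t => ∑ i ∈ I, f i t) s = ∑ i ∈ I, mellin (f i) s := by
  simp only [mellin, Finset.smul_sum]
  exact integral_finsetSum I h

lemma mellin_congr_of_pos {f g : ℝ → ℂ} (h : ∀ t : ℝ, 0 < t → f t = g t) (s : ℂ) :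
    mellin f s = mellin g s :=
  setIntegral_congr_fun measurableSet_Ioi fun t ht => by rw [h t ht]

/-- The continuation of `ξ` to the half-plane `Re s > -N`. -/
noncomputable def xiPartial (k : ℕ+) (l : List ℕ+) (N : ℕ) (s : ℂ) : ℂ :=
  ∑ n ∈ Finset.range N, (polylogCoeff k l (n + 1) : ℂ) * binomDirichlet n s +
    (Complex.Gamma s)⁻¹ * mellin (fun t => (xiRem k l N t : ℂ)) s

lemma differentiableAt_xiPartial (k : ℕ+) (l : List ℕ+) (N : ℕ) {s : ℂ}
    (hs : -(N : ℝ) < s.re) : DifferentiableAt ℂ (xiPartial k l N) s :=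
  (DifferentiableAt.fun_sum fun n _ => (differentiable_binomDirichlet n s).const_mul _).add
    ((Complex.differentiable_one_div_Gamma s).mul (differentiableAt_mellin_xiRem k l N hs))

lemma analyticAt_xiPartial (k : ℕ+) (l : List ℕ+) (N : ℕ) {s : ℂ}
    (hs : -(N : ℝ) < s.re) : AnalyticAt ℂ (xiPartial k l N) s :=
  DifferentiableOn.analyticAt (s := {s : ℂ | -(N : ℝ) < s.re})
    (fun _ hz => (differentiableAt_xiPartial k l N hz).differentiableWithinAt)
    (halfPlane_mem_nhds hs)

lemma xiPartial_eq (k : ℕ+) (l : List ℕ+) (N : ℕ) {s : ℂ} (hs : 0 < s.re) :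
    xiPartial k l N s = (Complex.Gamma s)⁻¹ * mellin (fun t => (xiKernel (k :: l) t : ℂ)) s := by
  have hΓ : Complex.Gamma s ≠ 0 := Complex.Gamma_ne_zero_of_re_pos hs
  have hN : (0 : ℝ) ≤ N := Nat.cast_nonneg N
  have hsum : MellinConvergent (fun t => ∑ n ∈ Finset.range N,
      (polylogCoeff k l (n + 1) : ℂ) • (expKernel n t : ℂ)) s := by
    simp only [MellinConvergent, Finset.smul_sum]
    exact integrable_finsetSum _ fun n _ => (mellinConvergent_expKernel n hs).const_smul _
  have h := (hasMellin_add (mellinConvergent_xiRem k l N (s := s) (by linarith)) hsum).2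
  have hk : ∀ t, (xiKernel (k :: l) t : ℂ) = (xiRem k l N t : ℂ) + ∑ n ∈ Finset.range N,
      (polylogCoeff k l (n + 1) : ℂ) • (expKernel n t : ℂ) := fun t => by
    simp only [xiRem, smul_eq_mul]
    push_cast
    ring
  simp only [hk]
  rw [h, mellin_finset_sum fun n _ => (mellinConvergent_expKernel n hs).const_smul _, mul_add,
    Finset.mul_sum, xiPartial, add_comm]
  congr 1
  refine Finset.sum_congr rfl fun n _ => ?_
  rw [mellin_const_smul, mellin_expKernel n hs, smul_eq_mul]
  field_simp

lemma xiRem_length (k : ℕ+) (l : List ℕ+) : xiRem k l l.length = xiKernel (k :: l) := by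
  funext t
  rw [xiRem, Finset.sum_eq_zero, sub_zero]
  intro n hn
  rw [polylogCoeff_eq_zero_of_le k l (Finset.mem_range.1 hn), zero_mul]

/-- For N = r - 1 all subtracted terms are zero, so this continuation is the original integral on
its full half-plane and no separate comparison is needed there. -/
lemma xiPartial_length (k : ℕ+) (l : List ℕ+) (s : ℂ) : xiPartial k l l.length s =
    (Complex.Gamma s)⁻¹ * mellin (fun t => (xiKernel (k :: l) t : ℂ)) s := by
  rw [xiPartial, xiRem_length, Finset.sum_eq_zero, zero_add]
  intro n hn
  rw [polylogCoeff_eq_zero_of_le k l (Finset.mem_range.1 hn), Complex.ofReal_zero, zero_mul]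

lemma exists_entire_xi (k : ℕ+) (l : List ℕ+) : ∃ G : ℂ → ℂ, Differentiable ℂ G ∧
    ∀ s : ℂ, -(l.length : ℝ) < s.re →
      G s = (Complex.Gamma s)⁻¹ * mellin (fun t => (xiKernel (k :: l) t : ℂ)) s := by
  obtain ⟨G, -, hGF⟩ := exists_glue_halfPlane (c := 0) (d := 0) (F := xiPartial k l)
    (fun N s hs => (analyticAt_xiPartial k l N (by simpa using hs)).meromorphicNFAt)
    (fun N s hs => xiPartial_eq k l N hs)
  refine ⟨G, fun s => ?_, fun s hs => ?_⟩
  · obtain ⟨N, hN⟩ := exists_nat_gt (0 - s.re)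
    have hN' : 0 - (N : ℝ) < s.re := by linarith
    refine (differentiableAt_xiPartial k l N (by linarith)).congr_of_eventuallyEq ?_
    filter_upwards [halfPlane_mem_nhds hN'] with t ht
    exact hGF N ht
  · rw [hGF l.length (show 0 - (l.length : ℝ) < s.re by linarith), xiPartial_length]

lemma xiIntegrand_append (l : MZIndex) (a : ℕ+) (s : ℂ) {t : ℝ} (ht : 0 < t) :
    xiIntegrand (l ++ [a]) s t = (t : ℂ) ^ (s - 1) • (xiKernel (a :: l.reverse) t : ℂ) := by
  have h := multiPolylog_ofReal l a (abs_one_sub_exp_neg_lt ht)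
  push_cast at h
  rw [xiIntegrand, h, xiKernel, smul_eq_mul]
  push_cast
  rfl

lemma xiIntegral_append (l : MZIndex) (a : ℕ+) (s : ℂ) : xiIntegral (l ++ [a]) s =
    (Complex.Gamma s)⁻¹ * mellin (fun t => (xiKernel (a :: l.reverse) t : ℂ)) s := by
  rw [xiIntegral, one_div, mellin]
  congr 1
  exact setIntegral_congr_fun measurableSet_Ioi fun t ht => xiIntegrand_append l a s ht

theorem xiFunction_spec (l : MZIndex) (a : ℕ+) : Differentiable ℂ (xiFunction (l ++ [a])) ∧
    ∀ s : ℂ, 1 - ((l ++ [a]).length : ℝ) < s.re →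
      IntegrableOn (xiIntegrand (l ++ [a]) s) (Ioi 0) ∧
        xiFunction (l ++ [a]) s = xiIntegral (l ++ [a]) s := by
  obtain ⟨G, hG, hGeq⟩ := exists_entire_xi a l.reverse
  have hlen : ∀ s : ℂ, 1 - ((l ++ [a]).length : ℝ) < s.re → -(l.reverse.length : ℝ) < s.re :=
    fun s hs => by
      simp only [List.length_append, List.length_singleton, List.length_reverse] at hs ⊢
      push_cast at hs
      linarith
  have hGx : EqOn G (xiIntegral (l ++ [a])) {s | 1 - ((l ++ [a]).length : ℝ) < s.re} :=
    fun s hs => by rw [hGeq s (hlen s hs), xiIntegral_append]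
  have hxi : xiFunction (l ++ [a]) = G := meromorphicContinuation_eq hG hGx
  rw [hxi]
  refine ⟨hG, fun s hs => ⟨?_, hGx hs⟩⟩
  have h := mellinConvergent_xiRem a l.reverse l.reverse.length (hlen s hs)
  rw [xiRem_length] at h
  exact IntegrableOn.congr_fun h (fun t ht => (xiIntegrand_append l a s ht).symm) measurableSet_Ioi

/-! ### Assembling the formula -/

lemma weight_reverse (l : List ℕ+) : MZIndex.weight l.reverse = wordWeight l := by
  simp [MZIndex.weight, wordWeight, List.sum_reverse]

/-- Terms are grouped by index and power of the logarithm. The weight bound is asked only where the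
coefficient is nonzero; elsewhere the truncated subtraction is harmless, since 0 lies in every span.
-/
lemma exists_finsupp_of_mem_logPolylogSpan {n : ℕ} {f : ℝ → ℝ} (hf : f ∈ logPolylogSpan n) :
    ∃ c : MZIndex × ℕ →₀ ℝ,
      (∀ p, (c p ≠ 0 → p.1.weight + p.2 ≤ n) ∧ c p ∈ multiZetaSpan (n - p.1.weight - p.2)) ∧
      ∀ z, f z = c.sum fun p a => a * (logPow p.2 z * wordPolylog p.1.reverse z) := by
  induction hf using Submodule.span_induction with
  | mem f hf =>
    obtain ⟨u, j, l, h, a, ha, rfl⟩ := hf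
    refine ⟨Finsupp.single (l.reverse, j) a, fun p => ?_, fun z => ?_⟩
    · by_cases hp : p = (l.reverse, j)
      · subst hp
        rw [Finsupp.single_eq_same]
        simp only [weight_reverse]
        exact ⟨fun _ => by omega, by rwa [show n - wordWeight l - j = u by omega]⟩
      · rw [Finsupp.single_eq_of_ne hp]
        exact ⟨fun h => absurd rfl h, Submodule.zero_mem _⟩
    · rw [Finsupp.sum_single_index (by simp), List.reverse_reverse]
  | zero => exact ⟨0, fun p => ⟨by simp, Submodule.zero_mem _⟩, fun z => by simp⟩
  | add f₁ f₂ _ _ h₁ h₂ =>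
    obtain ⟨c₁, hc₁, hf₁⟩ := h₁
    obtain ⟨c₂, hc₂, hf₂⟩ := h₂
    refine ⟨c₁ + c₂, fun p => ⟨fun hp => ?_, Submodule.add_mem _ (hc₁ p).2 (hc₂ p).2⟩,
      fun z => ?_⟩
    · by_cases h : c₁ p = 0
      · refine (hc₂ p).1 fun h' => hp ?_
        rw [Finsupp.add_apply, h, h', add_zero]
      · exact (hc₁ p).1 h
    · rw [Finsupp.sum_add_index' (by simp) (by intros; ring), Pi.add_apply, hf₁, hf₂]
  | smul q f _ h =>
    obtain ⟨c, hc, hf⟩ := h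
    refine ⟨q • c, fun p => ⟨fun hp => (hc p).1 fun h => hp ?_,
      Submodule.smul_mem _ _ (hc p).2⟩, fun z => ?_⟩
    · rw [Finsupp.smul_apply, h, smul_zero]
    · rw [Finsupp.sum_smul_index' (by simp), Pi.smul_apply, hf, Finsupp.smul_sum]
      refine Finsupp.sum_congr fun p _ => ?_
      simp only [Rat.smul_def]
      ring

lemma choose_eq_pochCoeff (s : ℂ) (j : ℕ) : Ring.choose (s + j - 1) j = pochCoeff j s := by
  have h := Ring.factorial_nsmul_multichoose_eq_ascPochhammer s j
  rw [Polynomial.ascPochhammer_smeval_eq_eval, Ring.multichoose_eq] at h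
  have hj : (j.factorial : ℂ) ≠ 0 := by exact_mod_cast j.factorial_ne_zero
  rw [pochCoeff, ← h, nsmul_eq_mul]
  field_simp

lemma Gamma_add_eq (s : ℂ) (hs : 0 < s.re) (j : ℕ) :
    Complex.Gamma (s + j) = Complex.Gamma s * ((j.factorial : ℂ) * pochCoeff j s) := by
  have hΓ : Complex.Gamma s ≠ 0 := Complex.Gamma_ne_zero_of_re_pos hs
  have h := Complex.Gamma_add_nat_div_Gamma_eq (n := j) s fun k hk => by
    rw [hk] at hs
    have : (0 : ℝ) ≤ k := Nat.cast_nonneg k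
    simp at hs
    linarith
  have hj : (j.factorial : ℂ) ≠ 0 := by exact_mod_cast j.factorial_ne_zero
  rw [pochCoeff, ← h]
  field_simp

/-- At z = e^(-t) the logarithmic factor is t^j / j!, which shifts the transform to s + j; the
quotient of Gamma values then supplies the binomial coefficient. -/
lemma mellin_xiKernel_eq {w : List ℕ+} {c : MZIndex × ℕ →₀ ℝ}
    (hc : ∀ z ∈ Ioo (0 : ℝ) 1, wordPolylog w (1 - z) =
      c.sum fun p a => a * (logPow p.2 z * wordPolylog p.1.reverse z)) {s : ℂ} (hs : 1 < s.re) :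
    (Complex.Gamma s)⁻¹ * mellin (fun t => (xiKernel w t : ℂ)) s =
      ∑ p ∈ c.support, (c p : ℂ) * Ring.choose (s + p.2 - 1) p.2 *
        multiZetaFunction p.1 (s + p.2) := by
  have hs0 : 0 < s.re := by linarith
  have hΓ : Complex.Gamma s ≠ 0 := Complex.Gamma_ne_zero_of_re_pos hs0
  have hre : ∀ j : ℕ, 1 < (s + j).re := fun j => by
    have : (0 : ℝ) ≤ j := Nat.cast_nonneg j
    rw [Complex.add_re, Complex.natCast_re]
    linarith
  have hker : ∀ t : ℝ, 0 < t → (xiKernel w t : ℂ) = ∑ p ∈ c.support,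
      ((c p / p.2.factorial : ℝ) : ℂ) •
        ((t : ℂ) ^ ((p.2 : ℕ) : ℂ) • (zetaKernel p.1.reverse t : ℂ)) := fun t ht => by
    have h : xiKernel w t = ∑ p ∈ c.support,
        (c p / p.2.factorial) * (t ^ p.2 * zetaKernel p.1.reverse t) := by
      rw [xiKernel, hc _ (exp_neg_mem_Ioo ht), Finsupp.sum, Finset.sum_div]
      refine Finset.sum_congr rfl fun p _ => ?_
      rw [logPow, Real.log_exp, neg_neg, zetaKernel]
      ring
    rw [h]
    push_cast
    simp only [smul_eq_mul, Complex.cpow_natCast]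
  have hconv : ∀ p ∈ c.support, MellinConvergent (fun t => ((c p / p.2.factorial : ℝ) : ℂ) •
      ((t : ℂ) ^ ((p.2 : ℕ) : ℂ) • (zetaKernel p.1.reverse t : ℂ))) s := fun p _ =>
    (MellinConvergent.cpow_smul.2 (mellinConvergent_zetaKernel _ (hre p.2))).const_smul _
  rw [mellin_congr_of_pos hker, mellin_finset_sum hconv, Finset.mul_sum]
  refine Finset.sum_congr rfl fun p _ => ?_
  have hj : (p.2.factorial : ℂ) ≠ 0 := by exact_mod_cast p.2.factorial_ne_zero
  rw [mellin_const_smul, mellin_cpow_smul, mellin_zetaKernel _ (hre p.2), Gamma_add_eq s hs0,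
    choose_eq_pochCoeff, ((multiZetaFunction_spec p.1).2 _ (hre p.2)).2.2.2, smul_eq_mul]
  push_cast
  field_simp

/-- The functions `ξ(k; s)` and `ζ(l; s)` are well defined (the first entire, the second
meromorphic), and `ξ(k; s) = ∑ c(k', j) * binom(s + j - 1, j) * ζ(k'; s + j)` as meromorphic
functions of `s`, that is, at every `s` where no term has a pole of its zeta factor. -/
theorem theorem3p5 (k : MZIndex) (hk : k ≠ []) :
    (Differentiable ℂ (xiFunction k) ∧
      ∀ s : ℂ, 1 - (k.length : ℝ) < s.re →
        MeasureTheory.IntegrableOn (xiIntegrand k s) (Set.Ioi 0) ∧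
          xiFunction k s = xiIntegral k s) ∧
    (∀ l : MZIndex, MeromorphicNFOn (multiZetaFunction l) Set.univ ∧
      ∀ s : ℂ, 1 < s.re →
        Summable (multiZetaTerm l s) ∧ AnalyticAt ℂ (multiZetaFunction l) s ∧
          multiZetaFunction l s = multiZetaSeries l s) ∧
    ∃ c : MZIndex × ℕ →₀ ℝ,
      (∀ p ∈ c.support, p.1.weight + p.2 ≤ k.weight ∧
        c p ∈ multiZetaSpan (k.weight - p.1.weight - p.2)) ∧
      ∀ s : ℂ, (∀ p ∈ c.support, AnalyticAt ℂ (multiZetaFunction p.1) (s + p.2)) →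
        xiFunction k s =
          ∑ p ∈ c.support,
            (c p : ℂ) * Ring.choose (s + p.2 - 1) p.2 * multiZetaFunction p.1 (s + p.2) := by
  obtain ⟨l, a, rfl⟩ : ∃ l a, k = l ++ [a] :=
    ⟨k.dropLast, k.getLast hk, (List.dropLast_append_getLast hk).symm⟩
  obtain ⟨hdiff, hxi⟩ := xiFunction_spec l a
  refine ⟨⟨hdiff, hxi⟩, fun l => ⟨(multiZetaFunction_spec l).1, fun s hs => ?_⟩, ?_⟩
  · obtain ⟨h1, h2, h3, -⟩ := (multiZetaFunction_spec l).2 s hs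
    exact ⟨h1, h2, h3⟩
  obtain ⟨f, hf, hfz⟩ := hasReflection (a :: l.reverse)
  obtain ⟨c, hc, hcf⟩ := exists_finsupp_of_mem_logPolylogSpan hf
  have hwt : wordWeight (a :: l.reverse) = MZIndex.weight (l ++ [a]) := by
    rw [← weight_reverse, List.reverse_cons, List.reverse_reverse]
  rw [hwt] at hc
  refine ⟨c, fun p hp => ⟨(hc p).1 (Finsupp.mem_support_iff.1 hp), (hc p).2⟩, fun s hs => ?_⟩
  set R : ℂ → ℂ := fun s => ∑ p ∈ c.support,
    (c p : ℂ) * Ring.choose (s + p.2 - 1) p.2 * multiZetaFunction p.1 (s + p.2) with hR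
  have hchoose : ∀ (j : ℕ) (s : ℂ), AnalyticAt ℂ (fun s : ℂ => Ring.choose (s + j - 1) j) s :=
    fun j s => by
      simp only [choose_eq_pochCoeff]
      exact (differentiable_pochCoeff j).analyticAt s
  have hRan : AnalyticAt ℂ R s := by
    refine Finset.analyticAt_fun_sum _ fun p hp =>
      (analyticAt_const.mul (hchoose p.2 s)).mul ?_
    exact AnalyticAt.comp (f := fun s : ℂ => s + p.2) (hs p hp) (by fun_prop)
  have hRm : MeromorphicOn R univ := fun z _ => MeromorphicAt.fun_sum fun p _ =>
    ((analyticAt_const.mul (hchoose p.2 z)).meromorphicAt).fun_mul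
      (((multiZetaFunction_spec p.1).1 (mem_univ _)).meromorphicAt.comp_add_const _)
  -- Any base point with real part above 1 would do; near it both sides are given by the convergent
  -- integral and series.
  have heq : xiFunction (l ++ [a]) =ᶠ[𝓝[≠] 2] R := by
    have h2 : (1 : ℝ) < (2 : ℂ).re := by simp
    filter_upwards [mem_nhdsWithin_of_mem_nhds (halfPlane_mem_nhds h2)] with z hz
    have hz' : 1 < z.re := hz
    have hlen : (0 : ℝ) ≤ (l ++ [a]).length := Nat.cast_nonneg _
    rw [(hxi z (by linarith)).2, xiIntegral_append]
    exact mellin_xiKernel_eq (fun y hy => (hfz y hy).trans (hcf y)) hz'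
  have hxm : MeromorphicOn (xiFunction (l ++ [a])) univ := fun z _ =>
    (hdiff.analyticAt z).meromorphicAt
  have hs' := hxm.eventuallyEq_nhdsNE_of_isPreconnected hRm isPreconnected_univ (mem_univ 2) heq
    (mem_univ s)
  -- Both sides are analytic at s, R by the assumption on the zeta factors, so equality near s
  -- passes to s itself.
  exact (((hdiff.analyticAt s).meromorphicNFAt.eventuallyEq_nhdsNE_iff_eventuallyEq_nhds
    hRan.meromorphicNFAt).1 hs').eq_of_nhds
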